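/- Let $\hbar>0$ and $\mathcal H=L^2(\mathbb R)$, with position $(Q\psi)(x)=x\psi(x)$, momentum $P=-i\hbar\,d/dx$, their spectral measures $\mathsf Q,\mathsf P$, the Weyl operators $W(q,p)=e^{\frac{i}{2\hbar}qp}e^{-\frac i\hbar qP}e^{\frac i\hbar pQ}$ and the parity operator $(\Pi\psi)(x)=\psi(-x)$. A state is a positive operator on $\mathcal H$ of trace $1$; an observable is a normalized positive operator measure $E$ on the Borel sets of $\mathbb R$ or $\mathbb R^2$; $\rho^E$ is the probability measure $X\mapsto\mathrm{tr}[\rho E(X)]$. Put $J_{x;w}=[x-\frac w2,x+\frac w2]$. For $\varepsilon\in(0,1)$ and observables $E_1,E$ on $\mathbb R$, the error bar width of $E_1$ relative to $E$ is $$\mathcal W_\varepsilon(E_1,E)=\inf_{\delta>0}\ \inf\{w>0\;|\;\forall x\in\mathbb R\ \forall\text{ states }\rho:\ \rho^E(J_{x;\delta})=1\Rightarrow\rho^{E_1}(J_{x;w})\ge 1-\varepsilon\}\in[0,\infty]$$ (with $\inf\emptyset=\infty$). $E_1$ is an approximation to $E$ if $\mathcal W_\varepsilon(E_1,E)<\infty$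 for all $\varepsilon\in(0,1)$, and an observable $M$ on $\mathbb R^2$ is an approximate joint observable for $\mathsf Q,\mathsf P$ if its marginals $M_1(X)=M(X\times\mathbb R)$ and $M_2(Y)=M(\mathbb R\times Y)$ are approximations to $\mathsf Q$ and $\mathsf P$, respectively. Let $\mathbf m$ be a state. Then the weak integral $$G^{\mathbf m}(Z)=\frac1{2\pi\hbar}\int_Z W(q,p)\,\mathbf m\,W(q,p)^*\,dq\,dp$$ exists for every Borel set $Z\subseteq\mathbb R^2$ and defines an observable $G^{\mathbf m}$ on $\mathbb R^2$, which is covariant: $W(q,p)G^{\mathbf m}(Z)W(q,p)^*=G^{\mathbf m}(Z+(q,p))$. Its marginals are $G^{\mathbf m}_1=\mathsf Q_{\mu_{\mathbf m}}$ and $G^{\mathbf m}_2=\mathsf P_{\nu_{\mathbf m}}$, where $\mu_{\mathbf m}=(\Pi\mathbf m\Pi^*)^{\mathsf Q}$, $\nu_{\mathbf m}=(\Pi\mathbf m\Pi^*)^{\mathsf P}$ and $\mathsf Q_\mu(X)=\int\mu(X-q)\,\mathsf Q(dq)$, $\mathsf P_\nu(Y)=\int\nu(Y-p)\,\mathsf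 P(dp)$ (weak integrals). Moreover, $G^{\mathbf m}$ is an approximate joint observable for $\mathsf Q,\mathsf P$, and $$\mathcal W_{\varepsilon_1}(\mathsf Q_{\mu_{\mathbf m}},\mathsf Q)\cdot\mathcal W_{\varepsilon_2}(\mathsf P_{\nu_{\mathbf m}},\mathsf P)\ \ge\ 2\pi\hbar\,(1-\varepsilon_1-\varepsilon_2)^2$$ for all $\varepsilon_1,\varepsilon_2>0$ with $\varepsilon_1+\varepsilon_2<1$. -/

import Mathlib

open MeasureTheory Set
open scoped ENNReal InnerProductSpace

noncomputable section

namespace PhaseSpace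

/-! ## Trace and states -/

section Trace

variable {H : Type*} [NormedAddCommGroup H] [InnerProductSpace ℂ H] [CompleteSpace H]

variable (H) in
/-- The index set of a fixed Hilbert basis of `H`. -/
def basisIndex : Set H := (exists_hilbertBasis ℂ H).choose

variable (H) in
/-- A fixed Hilbert basis of `H`. -/
def basis : HilbertBasis (basisIndex H) ℂ H := (exists_hilbertBasis ℂ H).choose_spec.choose

/-- The trace of a (trace class) operator, computed in the fixed Hilbert basis. -/
def trace (T : H →L[ℂ] H) : ℂ := ∑' i, ⟪basis H i, T (basis H i)⟫_ℂ

variable (H) in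
/-- States (density operators): positive operators of trace one. (For a positive operator,
a nonzero value of the series defining the trace means that the series converges.) -/
structure State where
  op : H →L[ℂ] H
  isPositive : op.IsPositive
  trace_eq_one : trace op = 1

/-- Parseval's identity with values in `[0, ∞]`. -/
lemma parseval {ι : Type*} (b : HilbertBasis ι ℂ H) (x : H) :
    ENNReal.ofReal (‖x‖ ^ 2) = ∑' i, ENNReal.ofReal (‖⟪b i, x⟫_ℂ‖ ^ 2) := by
  have h := b.hasSum_inner_mul_inner x x
  have e : ∀ i, ⟪x, b i⟫_ℂ * ⟪b i, x⟫_ℂ = ((‖⟪b i, x⟫_ℂ‖ ^ 2 : ℝ) : ℂ) := by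
    intro i
    rw [← inner_conj_symm x (b i), Complex.conj_mul']
    push_cast; rfl
  simp_rw [e] at h
  rw [inner_self_eq_norm_sq_to_K] at h
  have h' : HasSum (fun i => ‖⟪b i, x⟫_ℂ‖ ^ 2) (‖x‖ ^ 2) := by
    rw [← Complex.hasSum_ofReal, Complex.ofReal_pow]
    exact h
  rw [← h'.tsum_eq, ENNReal.ofReal_tsum_of_nonneg (fun i => by positivity) h'.summable]

/-- The Hilbert-Schmidt norms of an operator and of its adjoint agree, in any two bases. -/
lemma hilbertSchmidt_adjoint {ι κ : Type*} (b : HilbertBasis ι ℂ H) (c : HilbertBasis κ ℂ H)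
    (A : H →L[ℂ] H) :
    ∑' i, ENNReal.ofReal (‖A (b i)‖ ^ 2) = ∑' j, ENNReal.ofReal (‖A.adjoint (c j)‖ ^ 2) := by
  simp_rw [parseval c (A _), parseval b (A.adjoint _)]
  rw [ENNReal.tsum_comm]
  refine tsum_congr fun j => tsum_congr fun i => ?_
  rw [ContinuousLinearMap.adjoint_inner_right, norm_inner_symm]

/-- A state is of the form `R* R` with `R` a Hilbert-Schmidt operator of norm one. -/
lemma State.exists_factor (ρ : State H) : ∃ R : H →L[ℂ] H, ρ.op = R.adjoint ∘L R ∧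
    ∑' i, ENNReal.ofReal (‖R (basis H i)‖ ^ 2) = 1 := by
  have h0 : 0 ≤ ρ.op := (ContinuousLinearMap.nonneg_iff_isPositive _).2 ρ.isPositive
  obtain ⟨R, hR⟩ := CStarAlgebra.nonneg_iff_eq_star_mul_self.1 h0
  have hR' : ρ.op = R.adjoint ∘L R := hR
  refine ⟨R, hR', ?_⟩
  have e : ∀ i, ⟪basis H i, ρ.op (basis H i)⟫_ℂ = ((‖R (basis H i)‖ ^ 2 : ℝ) : ℂ) := by
    intro i
    rw [hR', ContinuousLinearMap.comp_apply, ContinuousLinearMap.adjoint_inner_right,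
      inner_self_eq_norm_sq_to_K]
    push_cast; rfl
  have ht := ρ.trace_eq_one
  unfold trace at ht
  simp_rw [e] at ht
  rw [← Complex.ofReal_tsum] at ht
  have ht' : ∑' i, ‖R (basis H i)‖ ^ 2 = (1 : ℝ) := by exact_mod_cast ht
  have hs : Summable fun i => ‖R (basis H i)‖ ^ 2 := by
    by_contra hn
    rw [tsum_eq_zero_of_not_summable hn] at ht'
    exact zero_ne_one ht'
  rw [← ENNReal.ofReal_tsum_of_nonneg (fun i => by positivity) hs, ht', ENNReal.ofReal_one]

/-- The trace of `A* A`, for a Hilbert-Schmidt operator `A` of norm one. -/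
lemma trace_adjoint_comp_self (A : H →L[ℂ] H)
    (hA : ∑' i, ENNReal.ofReal (‖A (basis H i)‖ ^ 2) = 1) : trace (A.adjoint ∘L A) = 1 := by
  have e : ∀ i, ⟪basis H i, (A.adjoint ∘L A) (basis H i)⟫_ℂ
      = ((‖A (basis H i)‖ ^ 2 : ℝ) : ℂ) := by
    intro i
    rw [ContinuousLinearMap.comp_apply, ContinuousLinearMap.adjoint_inner_right,
      inner_self_eq_norm_sq_to_K]
    push_cast; rfl
  unfold trace
  simp_rw [e]
  rw [← Complex.ofReal_tsum]
  have h := congrArg ENNReal.toReal hA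
  rw [ENNReal.tsum_toReal_eq (fun i => ENNReal.ofReal_ne_top), ENNReal.toReal_one] at h
  rw [show (∑' i, ‖A (basis H i)‖ ^ 2) = 1 from ?_, Complex.ofReal_one]
  rw [← h]
  exact tsum_congr fun i => (ENNReal.toReal_ofReal (by positivity)).symm

/-- The state `U ρ U*`, for a unitary operator `U`. -/
def State.conj (ρ : State H) (U : H ≃ₗᵢ[ℂ] H) : State H where
  op := (U : H →L[ℂ] H) ∘L ρ.op ∘L (U : H →L[ℂ] H).adjoint
  isPositive := ρ.isPositive.conj_adjoint _
  trace_eq_one := by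
    obtain ⟨R, hR, h1⟩ := ρ.exists_factor
    have e : (U : H →L[ℂ] H) ∘L ρ.op ∘L (U : H →L[ℂ] H).adjoint
        = (R ∘L (U : H →L[ℂ] H).adjoint).adjoint ∘L (R ∘L (U : H →L[ℂ] H).adjoint) := by
      rw [hR, ContinuousLinearMap.adjoint_comp, ContinuousLinearMap.adjoint_adjoint]
      rfl
    rw [e]
    apply trace_adjoint_comp_self
    rw [hilbertSchmidt_adjoint _ (basis H), ← h1, hilbertSchmidt_adjoint _ (basis H) R]
    refine tsum_congr fun j => ?_
    rw [ContinuousLinearMap.adjoint_comp, ContinuousLinearMap.adjoint_adjoint]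
    simp

/-- Cyclicity of the trace, in the form needed for probabilities of a state. -/
lemma hasSum_trace_comp (R B : H →L[ℂ] H)
    (hR : ∑' i, ENNReal.ofReal (‖R (basis H i)‖ ^ 2) ≠ ∞) (hB : B.IsPositive) :
    HasSum (fun j => ⟪R.adjoint (basis H j), B (R.adjoint (basis H j))⟫_ℂ)
      (trace ((R.adjoint ∘L R) ∘L B)) := by
  set b := basis H
  let f : basisIndex H × basisIndex H → ℂ := fun p =>
    ⟪R (b p.1), b p.2⟫_ℂ * ⟪b p.2, R (B (b p.1))⟫_ℂ
  have key : ∀ A : H →L[ℂ] H, ∑' i, ENNReal.ofReal (‖A (b i)‖ ^ 2) ≠ ∞ →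
      Summable fun p : basisIndex H × basisIndex H => ‖⟪b p.2, A (b p.1)⟫_ℂ‖ ^ 2 := by
    intro A hA
    have : ∑' p : basisIndex H × basisIndex H,
        ENNReal.ofReal (‖⟪b p.2, A (b p.1)⟫_ℂ‖ ^ 2) ≠ ∞ := by
      rw [ENNReal.tsum_prod']
      simp_rw [← parseval b]
      exact hA
    have := ENNReal.summable_toReal this
    exact this.congr fun p => ENNReal.toReal_ofReal (by positivity)
  have hRB : ∑' i, ENNReal.ofReal (‖(R ∘L B) (b i)‖ ^ 2) ≠ ∞ := by
    rw [hilbertSchmidt_adjoint b b]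
    rw [hilbertSchmidt_adjoint b b] at hR
    refine ne_top_of_le_ne_top (ENNReal.mul_ne_top
      (ENNReal.ofReal_ne_top (r := ‖B.adjoint‖ ^ 2)) hR) ?_
    rw [← ENNReal.tsum_mul_left]
    refine ENNReal.tsum_le_tsum fun j => ?_
    rw [← ENNReal.ofReal_mul (by positivity), ← mul_pow]
    apply ENNReal.ofReal_le_ofReal
    rw [ContinuousLinearMap.adjoint_comp]
    gcongr
    exact B.adjoint.le_opNorm _
  have hf : Summable f := by
    refine Summable.of_norm_bounded (((key R hR).add (key _ hRB)).mul_left (1 / 2)) fun p => ?_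
    simp only [f, norm_mul, ContinuousLinearMap.comp_apply]
    rw [norm_inner_symm (R (b p.1))]
    nlinarith [sq_nonneg (‖⟪b p.2, R (b p.1)⟫_ℂ‖ - ‖⟪b p.2, R (B (b p.1))⟫_ℂ‖)]
  have h1 : ∀ i, HasSum (fun j => f (i, j)) ⟪b i, ((R.adjoint ∘L R) ∘L B) (b i)⟫_ℂ := by
    intro i
    simpa [f, ContinuousLinearMap.adjoint_inner_right] using
      b.hasSum_inner_mul_inner (R (b i)) (R (B (b i)))
  have h2 : ∀ j, HasSum (fun i => f (i, j)) ⟪R.adjoint (b j), B (R.adjoint (b j))⟫_ℂ := by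
    intro j
    have := b.hasSum_inner_mul_inner (B (R.adjoint (b j))) (R.adjoint (b j))
    rw [hB.inner_left_eq_inner_right] at this
    refine this.congr_fun ?_ |> id
    intro i
    simp only [f]
    rw [hB.inner_left_eq_inner_right, ContinuousLinearMap.adjoint_inner_left,
      ContinuousLinearMap.adjoint_inner_right, mul_comm]
  have hT : trace ((R.adjoint ∘L R) ∘L B) = ∑' p, f p :=
    ((hf.hasSum.prod_fiberwise h1).tsum_eq).symm ▸ rfl
  rw [hT]
  have hf' : HasSum (fun p : basisIndex H × basisIndex H => f p.swap) (∑' p, f p) :=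
    (Equiv.prodComm _ _).hasSum_iff.2 hf.hasSum
  exact hf'.prod_fiberwise h2

end Trace

/-! ## Observables -/

/-- Observables: normalized positive operator measures on a measurable space, countably
additive in the weak operator topology. By convention, they vanish on non-measurable sets. -/
@[ext]
structure Observable (α : Type*) [MeasurableSpace α] (H : Type*) [NormedAddCommGroup H]
    [InnerProductSpace ℂ H] [CompleteSpace H] where
  toFun : Set α → H →L[ℂ] H
  not_measurable : ∀ X, ¬ MeasurableSet X → toFun X = 0
  isPositive : ∀ X, (toFun X).IsPositive
  univ : toFun univ = 1
  hasSum_iUnion : ∀ X : ℕ → Set α, (∀ n, MeasurableSet (X n)) →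
    Pairwise (fun m n => Disjoint (X m) (X n)) →
    ∀ φ ψ : H, HasSum (fun n => ⟪φ, toFun (X n) ψ⟫_ℂ) ⟪φ, toFun (⋃ n, X n) ψ⟫_ℂ

namespace Observable

variable {α β : Type*} [MeasurableSpace α] [MeasurableSpace β]
variable {H : Type*} [NormedAddCommGroup H] [InnerProductSpace ℂ H] [CompleteSpace H]

instance : CoeFun (Observable α H) (fun _ => Set α → H →L[ℂ] H) := ⟨toFun⟩

lemma ofReal_inner_iUnion (E : Observable α H) (ψ : H) (X : ℕ → Set α)
    (hX : ∀ n, MeasurableSet (X n)) (hd : Pairwise (fun m n => Disjoint (X m) (X n))) :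
    ENNReal.ofReal (⟪ψ, E (⋃ n, X n) ψ⟫_ℂ).re = ∑' n, ENNReal.ofReal (⟪ψ, E (X n) ψ⟫_ℂ).re := by
  have h := Complex.hasSum_re (E.hasSum_iUnion X hX hd ψ ψ)
  rw [← h.tsum_eq, ENNReal.ofReal_tsum_of_nonneg _ h.summable]
  exact fun n => (E.isPositive (X n)).re_inner_nonneg_right ψ

lemma apply_empty (E : Observable α H) : E ∅ = 0 := by
  refine ContinuousLinearMap.ext fun ψ => ext_inner_left ℂ fun φ => ?_
  have h := E.hasSum_iUnion (fun _ => ∅) (fun _ => MeasurableSet.empty)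
    (fun _ _ _ => by simp) φ ψ
  have := h.summable
  rw [summable_const_iff] at this
  simpa using this

/-- The measure `X ↦ ⟨ψ, E(X) ψ⟩`, for a vector `ψ`. -/
def vectorDistribution (E : Observable α H) (ψ : H) : Measure α :=
  Measure.ofMeasurable (fun X _ => ENNReal.ofReal (⟪ψ, E X ψ⟫_ℂ).re)
    (by simp [E.apply_empty]) (fun X hX hd => E.ofReal_inner_iUnion ψ X hX hd)

/-- The probabilities `tr (ρ E(X))` are sums of quadratic forms of `E(X)`, by cyclicity of the
trace. -/
lemma ofReal_trace (E : Observable α H) (ρ : State H) : ∃ v : basisIndex H → H, ∀ X,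
    ENNReal.ofReal (trace (ρ.op ∘L E X)).re = ∑' j, ENNReal.ofReal (⟪v j, E X (v j)⟫_ℂ).re := by
  obtain ⟨R, hR, h1⟩ := ρ.exists_factor
  refine ⟨fun j => R.adjoint (basis H j), fun X => ?_⟩
  have h := Complex.hasSum_re (hasSum_trace_comp R (E X) (by rw [h1]; simp) (E.isPositive X))
  rw [hR, ← h.tsum_eq, ENNReal.ofReal_tsum_of_nonneg _ h.summable]
  exact fun n => (E.isPositive X).re_inner_nonneg_right _

/-- The probability measure `ρ^E`, given by `ρ^E(X) = tr (ρ E(X))`. -/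
def distribution (E : Observable α H) (ρ : State H) : Measure α :=
  Measure.ofMeasurable (fun X _ => ENNReal.ofReal (trace (ρ.op ∘L E X)).re)
    (by simp [E.apply_empty, trace])
    (fun X hX hd => by
      obtain ⟨v, hv⟩ := E.ofReal_trace ρ
      simp_rw [hv, E.ofReal_inner_iUnion _ X hX hd]
      exact ENNReal.tsum_comm)

open Classical in
/-- The image of an observable under a measurable map, `X ↦ E(f⁻¹(X))`. -/
def map (E : Observable α H) (f : α → β) (hf : Measurable f) : Observable β H where
  toFun X := if MeasurableSet X then E (f ⁻¹' X) else 0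
  not_measurable X hX := if_neg hX
  isPositive X := by
    split_ifs
    · exact E.isPositive _
    · exact ContinuousLinearMap.isPositive_zero
  univ := by simp [E.univ]
  hasSum_iUnion X hX hd φ ψ := by
    simp only [hX, MeasurableSet.iUnion hX, if_true, preimage_iUnion]
    exact E.hasSum_iUnion (fun n => f ⁻¹' X n) (fun n => hf (hX n))
      (fun m n hmn => (hd hmn).preimage f) φ ψ

/-- The observable `X ↦ U* E(X) U`, for a unitary operator `U`. -/
def conj (E : Observable α H) (U : H ≃ₗᵢ[ℂ] H) : Observable α H where
  toFun X := (U : H →L[ℂ] H).adjoint ∘L E X ∘L (U : H →L[ℂ] H)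
  not_measurable X hX := by rw [E.not_measurable X hX]; simp
  isPositive X := (E.isPositive X).adjoint_conj _
  univ := by
    rw [E.univ]
    refine ContinuousLinearMap.ext fun ψ => ext_inner_left ℂ fun φ => ?_
    simp
  hasSum_iUnion X hX hd φ ψ := by
    simp only [ContinuousLinearMap.comp_apply, ContinuousLinearMap.adjoint_inner_right]
    exact E.hasSum_iUnion X hX hd (U φ) (U ψ)

/-- The first marginal, `X ↦ M(X × ℝ)`. -/
def fst (M : Observable (ℝ × ℝ) H) : Observable ℝ H := M.map Prod.fst measurable_fst

/-- The second marginal, `Y ↦ M(ℝ × Y)`. -/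
def snd (M : Observable (ℝ × ℝ) H) : Observable ℝ H := M.map Prod.snd measurable_snd

/-! ## Error bars -/

/-- The closed interval of length `w` centred at `x`. -/
def interval (x w : ℝ) : Set ℝ := Icc (x - w / 2) (x + w / 2)

/-- The error of `E₁` relative to `E`, for inputs localized within `δ`, at confidence level
`1 - ε`. The infimum is `∞` if no width qualifies. -/
def error (ε δ : ℝ) (E₁ E : Observable ℝ H) : ℝ≥0∞ :=
  sInf {W | ∃ w : ℝ, 0 < w ∧ W = ENNReal.ofReal w ∧
    ∀ (x : ℝ) (ρ : State H), E.distribution ρ (interval x δ) = 1 →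
      ENNReal.ofReal (1 - ε) ≤ E₁.distribution ρ (interval x w)}

/-- The error bar width of `E₁` relative to `E`, at confidence level `1 - ε`. -/
def errorBarWidth (ε : ℝ) (E₁ E : Observable ℝ H) : ℝ≥0∞ :=
  ⨅ (δ : ℝ) (_ : 0 < δ), error ε δ E₁ E

/-- `E₁` is an approximation to `E`: all error bar widths are finite. -/
def IsApproximation (E₁ E : Observable ℝ H) : Prop :=
  ∀ ε : ℝ, 0 < ε → ε < 1 → errorBarWidth ε E₁ E < ∞

/-- `M` is an approximate joint observable of `E₁`, `E₂`. -/
def IsApproximateJoint (M : Observable (ℝ × ℝ) H) (E₁ E₂ : Observable ℝ H) : Prop :=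
  M.fst.IsApproximation E₁ ∧ M.snd.IsApproximation E₂

/-- `F` is the smearing (convolution) of `E` by the measure `μ`:
`F(X) = ∫ μ(X - q) E(dq)` in the weak sense, where `X - q = {x | x + q ∈ X}`. -/
def IsSmearing (F E : Observable ℝ H) (μ : Measure ℝ) : Prop :=
  ∀ X, MeasurableSet X → ∀ ψ : H,
    ⟪ψ, F X ψ⟫_ℂ = ((∫ q, μ.real ((fun x => x + q) ⁻¹' X) ∂(E.vectorDistribution ψ) : ℝ) : ℂ)

end Observable

/-! ## Position, momentum and Weyl operators on `L²(ℝ)` -/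

/-- The Hilbert space `L²(ℝ)`. -/
abbrev L2R := Lp ℂ 2 (volume : Measure ℝ)

/-- The operator of multiplication by an essentially bounded function on `L²(ℝ)`. -/
def mulOp (g : ℝ → ℂ) (hg : MemLp g ∞ (volume : Measure ℝ)) : L2R →L[ℂ] L2R :=
  (ContinuousLinearMap.mul ℂ ℂ).holderL volume ∞ 2 2 hg.toLp

lemma mulOp_ae (g : ℝ → ℂ) (hg : MemLp g ∞ (volume : Measure ℝ)) (ψ : L2R) :
    mulOp g hg ψ =ᵐ[volume] fun x => g x * ψ x := by
  have h := (ContinuousLinearMap.mul ℂ ℂ).coeFn_holder (r := 2) hg.toLp ψ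
  filter_upwards [h, hg.coeFn_toLp] with x h1 h2
  rw [← h2]
  exact h1

lemma memLp_indicator (X : Set ℝ) (hX : MeasurableSet X) :
    MemLp (X.indicator fun _ => (1 : ℂ)) ∞ (volume : Measure ℝ) :=
  (memLp_top_const 1).indicator hX

lemma inner_mulOp_indicator (X : Set ℝ) (hX : MeasurableSet X) (φ ψ : L2R) :
    ⟪φ, mulOp _ (memLp_indicator X hX) ψ⟫_ℂ = ∫ x in X, ⟪φ x, ψ x⟫_ℂ := by
  rw [L2.inner_def, ← integral_indicator hX]
  refine integral_congr_ae ?_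
  filter_upwards [mulOp_ae _ (memLp_indicator X hX) ψ] with x hx
  rw [hx]
  by_cases h : x ∈ X <;> simp [h]

open Classical in
/-- The spectral measure of the position operator: `𝖰(X)` is multiplication by the indicator
function of `X`. -/
def position : Observable ℝ L2R where
  toFun X := if hX : MeasurableSet X then mulOp _ (memLp_indicator X hX) else 0
  not_measurable X hX := dif_neg hX
  isPositive X := by
    split_ifs with hX
    · rw [ContinuousLinearMap.isPositive_iff_complex]
      intro ψ
      rw [← inner_conj_symm, inner_mulOp_indicator X hX]
      have : ∫ x in X, ⟪ψ x, ψ x⟫_ℂ = ((∫ x in X, ‖ψ x‖ ^ 2 : ℝ) : ℂ) := by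
        rw [← integral_complex_ofReal]
        refine integral_congr_ae (Filter.Eventually.of_forall fun x => ?_)
        simp only [inner_self_eq_norm_sq_to_K]
        push_cast; rfl
      rw [this, Complex.conj_ofReal]
      refine ⟨by simp, ?_⟩
      simp only [RCLike.re_eq_complex_re, Complex.ofReal_re]
      exact integral_nonneg fun x => by positivity
    · exact ContinuousLinearMap.isPositive_zero
  univ := by
    rw [dif_pos MeasurableSet.univ]
    refine ContinuousLinearMap.ext fun ψ => ext_inner_left ℂ fun φ => ?_
    rw [inner_mulOp_indicator _ MeasurableSet.univ, setIntegral_univ, one_apply_eq_self, L2.inner_def]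
  hasSum_iUnion X hX hd φ ψ := by
    simp only [hX, MeasurableSet.iUnion hX, dif_pos, inner_mulOp_indicator]
    exact hasSum_integral_iUnion hX hd (L2.integrable_inner φ ψ).integrableOn

/-- The spectral measure of the momentum operator `P = -iħ d/dx`. The Fourier transform
`(ℱψ)(ξ) = ∫ exp(-2πixξ) ψ(x) dx` carries `P` into multiplication by `2πħξ`, so that
`𝖯(Y) = ℱ* 𝖰({ξ | 2πħξ ∈ Y}) ℱ`. -/
def momentum (ħ : ℝ) : Observable ℝ L2R :=
  (position.map (fun ξ => 2 * Real.pi * ħ * ξ) (by fun_prop)).conj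
    (Lp.fourierTransformₗᵢ ℝ ℂ)

/-- The translation `(exp(-iqP/ħ) ψ)(x) = ψ(x - q)`. -/
def translation (q : ℝ) : L2R →L[ℂ] L2R :=
  (Lp.compMeasurePreservingₗᵢ ℂ (fun x : ℝ => x - q)
    (measurePreserving_sub_right volume q)).toContinuousLinearMap

lemma memLp_phase (p ħ : ℝ) :
    MemLp (fun x : ℝ => Complex.exp (Complex.I * (p * x / ħ : ℝ))) ∞ (volume : Measure ℝ) :=
  memLp_top_of_bound (by fun_prop) 1
    (Filter.Eventually.of_forall fun x => by rw [mul_comm, Complex.norm_exp_ofReal_mul_I])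

/-- The boost `(exp(ipQ/ħ) ψ)(x) = exp(ipx/ħ) ψ(x)`. -/
def boost (ħ p : ℝ) : L2R →L[ℂ] L2R := mulOp _ (memLp_phase p ħ)

/-- The Weyl operators `W(q,p) = exp(iqp/2ħ) exp(-iqP/ħ) exp(ipQ/ħ)`. -/
def weyl (ħ : ℝ) (z : ℝ × ℝ) : L2R →L[ℂ] L2R :=
  Complex.exp (Complex.I * (z.1 * z.2 / (2 * ħ) : ℝ)) • (translation z.1 ∘L boost ħ z.2)

/-- The parity operator `(Πψ)(x) = ψ(-x)`. -/
def parity : L2R ≃ₗᵢ[ℂ] L2R :=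
  LinearIsometryEquiv.ofSurjective
    (Lp.compMeasurePreservingₗᵢ ℂ (fun x : ℝ => -x) (Measure.measurePreserving_neg volume))
    (fun ψ => by
      refine ⟨Lp.compMeasurePreserving (fun x : ℝ => -x)
        (Measure.measurePreserving_neg volume) ψ, ?_⟩
      have hq := (Measure.measurePreserving_neg (volume : Measure ℝ)).quasiMeasurePreserving
      have h1 := Lp.coeFn_compMeasurePreserving ψ
        (Measure.measurePreserving_neg (volume : Measure ℝ))
      refine Lp.ext ?_
      refine (Lp.coeFn_compMeasurePreserving _ _).trans ?_
      filter_upwards [hq.ae h1] with x hx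
      simpa using hx)

/-! ## Covariant phase space observables -/

/-- The covariance condition `W(q,p) G(Z) W(q,p)* = G(Z + (q,p))`. -/
def IsCovariant (ħ : ℝ) (G : Observable (ℝ × ℝ) L2R) : Prop :=
  ∀ Z, MeasurableSet Z → ∀ a : ℝ × ℝ,
    weyl ħ a ∘L G Z ∘L (weyl ħ a).adjoint = G ((fun z => z + a) '' Z)

/-- `G` is the observable `G^m` generated by `m`:
`G(Z) = (2πħ)⁻¹ ∫_Z W(q,p) m W(q,p)* dq dp` as a weak integral. -/
def IsGeneratedBy (ħ : ℝ) (G : Observable (ℝ × ℝ) L2R) (m : State L2R) : Prop :=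
  ∀ Z, MeasurableSet Z → ∀ φ ψ : L2R,
    IntegrableOn (fun z => ⟪φ, weyl ħ z (m.op ((weyl ħ z).adjoint ψ))⟫_ℂ) Z volume ∧
    ⟪φ, G Z ψ⟫_ℂ = ((2 * Real.pi * ħ)⁻¹ : ℝ) *
      ∫ z in Z, ⟪φ, weyl ħ z (m.op ((weyl ħ z).adjoint ψ))⟫_ℂ

/-- The probability measure `μ_m`: the position distribution of `Π m Π*`. -/
def positionNoise (m : State L2R) : Measure ℝ := position.distribution (m.conj parity)

/-- The probability measure `ν_m`: the momentum distribution of `Π m Π*`. -/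
def momentumNoise (ħ : ℝ) (m : State L2R) : Measure ℝ :=
  (momentum ħ).distribution (m.conj parity)

end PhaseSpace

end

open PhaseSpace

noncomputable section

namespace PhaseSpace

open scoped FourierTransform SchwartzMap

/-! Write `m = R* R` with `R` Hilbert-Schmidt (`State.exists_factor`). Then the density of `⟨ψ,
G(·)ψ⟩` at `z` is `‖R W(z)* ψ‖² / 2πħ`, and Parseval turns it into a sum of terms `|⟨ψ, W(z) v⟩|² /
2πħ` with `v = R* e_j`. Everything about `G` follows from one computation for a pair of vectors. For
fixed `q`, the matrix coefficient is, up to a phase and a rescaling of `p`, the Fourier transform of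
`conj ψ · v(· - q)`. Plancherel in `p` therefore leaves `∫ |ψ(x)|² |v(x - q)|² dx`, the convolution
of the position densities of `ψ` and `Πv` (`lintegral_ambiguity`). The Fourier transform rotates
phase space by a quarter turn, which gives the momentum marginal in the same way
(`lintegral_ambiguity_swap`).

The total integral over phase space is `2πħ ‖ψ‖²`, so `ψ ↦ (2πħ)^{-1/2} R W(·)* ψ` is an isometry
`V` and `G(Z) = V* 1_Z V` is an observable. Covariance holds because the Weyl operators compose up
to a phase, which cancels in `W m W*`, and Lebesgue measure is translation invariant.

A smearing by a probability measure is always an approximation, since the noise is tight. Feeding in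
states localized in ever smaller intervals shows that error bars of widths `w`, `w'` force the two
noises to put mass `1 - ε₁` and `1 - ε₂` on centred intervals of lengths arbitrarily close to `w`,
`w'`. These noises are the position and momentum distributions of the single state `ΠmΠ*`, so a
concentration inequality finishes the proof. For projections `Q`, `P` onto a position interval and a
momentum interval, `‖PQ‖² ≤ ww'/2πħ`; this bounds `Q + P` by `1 + ‖PQ‖`, hence `(1 - ε₁) + (1 - ε₂)
≤ 1 + (ww'/2πħ)^{1/2}`. -/

/-- The Fourier transform on `L²(ℝ)`. -/
abbrev fourierL2 : L2R ≃ₗᵢ[ℂ] L2R := Lp.fourierTransformₗᵢ ℝ ℂ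

/-- The Fourier transform on `L²` is given by the Fourier integral on `L¹ ∩ L²`. -/
lemma fourierL2_toLp_ae {f : ℝ → ℂ} (h1 : Integrable f) (h2 : MemLp f 2 volume) :
    fourierL2 h2.toLp =ᵐ[volume] 𝓕 f := by
  have hc : Continuous (𝓕 f) := VectorFourier.fourierIntegral_continuous Real.continuous_fourierChar
    (L := innerₗ ℝ) continuous_inner h1
  -- Both sides are locally integrable, so it suffices to test against smooth compactly supported
  -- functions; these are Schwartz, and the transform can be moved onto the test function on either
  -- side.
  refine ae_eq_of_integral_contDiff_smul_eq
    ((Lp.memLp _).locallyIntegrable (by norm_num)) hc.locallyIntegrable fun g hg hgc => ?_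
  have hgc' : HasCompactSupport (fun x => (g x : ℂ)) := hgc.comp_left (g := Complex.ofReal) rfl
  have hg' : ContDiff ℝ (⊤ : ℕ∞) (fun x => (g x : ℂ)) := Complex.ofRealCLM.contDiff.comp hg
  let s : 𝓢(ℝ, ℂ) := hgc'.toSchwartzMap hg'
  have key := congrArg (fun T : 𝓢'(ℝ, ℂ) => T s)
    (Lp.fourier_toTemperedDistribution_eq (h2.toLp f))
  simp only [TemperedDistribution.fourier_apply, Lp.toTemperedDistribution_apply] at key
  have e1 : ∫ x, g x • (fourierL2 h2.toLp : L2R) x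
      = ∫ x, s x • ((𝓕 (h2.toLp f : L2R) : L2R)) x := rfl
  rw [e1, ← key]
  have e2 : ∫ x, (𝓕 s) x • (h2.toLp f : L2R) x = ∫ x, 𝓕 (s : ℝ → ℂ) x • f x := by
    refine integral_congr_ae ?_
    filter_upwards [h2.coeFn_toLp] with x hx
    rw [hx, SchwartzMap.fourier_coe]
  rw [e2]
  have := VectorFourier.integral_fourierIntegral_smul_eq_flip (μ := volume) (ν := volume)
    (L := innerₗ ℝ) Real.continuous_fourierChar continuous_inner s.integrable h1
  rw [flip_innerₗ] at this
  exact this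

/-! ### Translations, modulations and parity under the Fourier transform -/

lemma translation_ae (q : ℝ) (ψ : L2R) : translation q ψ =ᵐ[volume] fun x => ψ (x - q) :=
  Lp.coeFn_compMeasurePreserving ψ (measurePreserving_sub_right volume q)

lemma boost_ae (ħ p : ℝ) (ψ : L2R) :
    boost ħ p ψ =ᵐ[volume] fun x => Complex.exp (Complex.I * (p * x / ħ : ℝ)) * ψ x :=
  mulOp_ae _ _ ψ

lemma parity_ae (ψ : L2R) : parity ψ =ᵐ[volume] fun x => ψ (-x) :=
  Lp.coeFn_compMeasurePreserving ψ (Measure.measurePreserving_neg volume)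

/-- Two continuous maps on `L²(ℝ)` agree if they agree on `L¹ ∩ L²`. -/
lemma eq_of_eq_on_integrable {Φ Ψ : L2R → L2R} (hΦ : Continuous Φ) (hΨ : Continuous Ψ)
    (h : ∀ (f : ℝ → ℂ) (_ : Integrable f) (h2 : MemLp f 2 volume), Φ h2.toLp = Ψ h2.toLp)
    (ψ : L2R) : Φ ψ = Ψ ψ := by
  refine DenseRange.induction_on (p := fun ψ => Φ ψ = Ψ ψ)
    (SchwartzMap.denseRange_toLpCLM (E := ℝ) (F := ℂ) (μ := volume) (p := 2) ENNReal.ofNat_ne_top)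
    ψ (isClosed_eq hΦ hΨ) fun s => ?_
  exact h s s.integrable (s.memLp 2)

/-- Modulation, `(M_b ψ)(x) = exp(2πibx) ψ(x)`. -/
abbrev modulation (b : ℝ) : L2R →L[ℂ] L2R := boost (2 * Real.pi)⁻¹ b

lemma modulation_ae (b : ℝ) (ψ : L2R) :
    modulation b ψ =ᵐ[volume] fun x => (Real.fourierChar (b * x) : ℂ) * ψ x := by
  filter_upwards [boost_ae (2 * Real.pi)⁻¹ b ψ] with x hx
  rw [hx, Real.fourierChar_apply]
  congr 2
  push_cast
  field_simp

lemma boost_eq_modulation (ħ p : ℝ) : boost ħ p = modulation (p / (2 * Real.pi * ħ)) := by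
  refine ContinuousLinearMap.ext fun ψ => Lp.ext ?_
  filter_upwards [boost_ae ħ p ψ, boost_ae (2 * Real.pi)⁻¹ (p / (2 * Real.pi * ħ)) ψ] with x h1 h2
  rw [h1, h2]
  congr 4
  have := Real.pi_ne_zero
  -- Division by zero gives zero, so both phases are trivial at `ħ = 0`.
  rcases eq_or_ne ħ 0 with rfl | hħ
  · simp
  · field_simp

lemma fourier_comp_sub (f : ℝ → ℂ) (q ξ : ℝ) :
    𝓕 (fun x => f (x - q)) ξ = (Real.fourierChar (-q * ξ) : ℂ) * 𝓕 f ξ := by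
  simp only [Real.fourier_real_eq, Circle.smul_def, smul_eq_mul]
  rw [← integral_const_mul, ← integral_add_right_eq_self _ q]
  refine integral_congr_ae (Filter.Eventually.of_forall fun x => ?_)
  simp only [add_sub_cancel_right]
  rw [← mul_assoc, ← Circle.coe_mul, ← AddChar.map_add_eq_mul]
  ring_nf

lemma fourier_modulate (f : ℝ → ℂ) (b ξ : ℝ) :
    𝓕 (fun x => (Real.fourierChar (b * x) : ℂ) * f x) ξ = 𝓕 f (ξ - b) := by
  simp only [Real.fourier_real_eq, Circle.smul_def, smul_eq_mul]
  refine integral_congr_ae (Filter.Eventually.of_forall fun x => ?_)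
  simp only
  rw [← mul_assoc, ← Circle.coe_mul, ← AddChar.map_add_eq_mul]
  ring_nf

lemma fourier_comp_neg (f : ℝ → ℂ) (ξ : ℝ) : 𝓕 (fun x => f (-x)) ξ = 𝓕 f (-ξ) := by
  simp only [Real.fourier_real_eq, Circle.smul_def, smul_eq_mul]
  rw [← integral_neg_eq_self]
  refine integral_congr_ae (Filter.Eventually.of_forall fun x => ?_)
  simp

lemma ae_comp_sub {p : ℝ → Prop} (h : ∀ᵐ x, p x) (a : ℝ) : ∀ᵐ x, p (x - a) :=
  (measurePreserving_sub_right volume a).quasiMeasurePreserving.ae h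

lemma ae_comp_neg {p : ℝ → Prop} (h : ∀ᵐ x, p x) : ∀ᵐ x, p (-x) :=
  (Measure.measurePreserving_neg (volume : Measure ℝ)).quasiMeasurePreserving.ae h

lemma fourierL2_translation (q : ℝ) (ψ : L2R) :
    fourierL2 (translation q ψ) = modulation (-q) (fourierL2 ψ) := by
  refine eq_of_eq_on_integrable (Φ := fun ψ => fourierL2 (translation q ψ))
    (Ψ := fun ψ => modulation (-q) (fourierL2 ψ)) (by fun_prop) (by fun_prop) (fun f h1 h2 => ?_) ψ
  have h2' : MemLp (fun x => f (x - q)) 2 volume :=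
    h2.comp_measurePreserving (measurePreserving_sub_right volume q)
  have e : translation q h2.toLp = h2'.toLp := by
    refine Lp.ext ?_
    filter_upwards [translation_ae q h2.toLp, h2'.coeFn_toLp, ae_comp_sub h2.coeFn_toLp q]
      with x a1 a2 a3
    rw [a1, a2, a3]
  rw [e]
  refine Lp.ext ?_
  filter_upwards [fourierL2_toLp_ae (h1.comp_sub_right q) h2', fourierL2_toLp_ae h1 h2,
    modulation_ae (-q) (fourierL2 h2.toLp)] with ξ a1 a2 a3
  rw [a1, a3, a2, fourier_comp_sub]

lemma fourierL2_modulation (b : ℝ) (ψ : L2R) :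
    fourierL2 (modulation b ψ) = translation b (fourierL2 ψ) := by
  refine eq_of_eq_on_integrable (Φ := fun ψ => fourierL2 (modulation b ψ))
    (Ψ := fun ψ => translation b (fourierL2 ψ)) (by fun_prop) (by fun_prop) (fun f h1 h2 => ?_) ψ
  have hm : AEStronglyMeasurable (fun x => (Real.fourierChar (b * x) : ℂ) * f x) volume := by
    refine AEStronglyMeasurable.mul (Continuous.aestronglyMeasurable ?_) h1.1
    exact continuous_subtype_val.comp (Real.continuous_fourierChar.comp (by fun_prop))
  have hn : ∀ᵐ x, ‖(Real.fourierChar (b * x) : ℂ) * f x‖ = ‖f x‖ :=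
    Filter.Eventually.of_forall fun x => by
      rw [norm_mul, Circle.norm_coe, one_mul]
  have h1' : Integrable (fun x => (Real.fourierChar (b * x) : ℂ) * f x) :=
    h1.congr' hm (hn.mono fun x hx => hx.symm)
  have h2' : MemLp (fun x => (Real.fourierChar (b * x) : ℂ) * f x) 2 volume :=
    h2.congr_norm hm (hn.mono fun x hx => hx.symm)
  have e : modulation b h2.toLp = h2'.toLp := by
    refine Lp.ext ?_
    filter_upwards [modulation_ae b h2.toLp, h2'.coeFn_toLp, h2.coeFn_toLp] with x a1 a2 a3
    rw [a1, a2, a3]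
  rw [e]
  refine Lp.ext ?_
  filter_upwards [fourierL2_toLp_ae h1' h2', ae_comp_sub (fourierL2_toLp_ae h1 h2) b,
    translation_ae b (fourierL2 h2.toLp)] with ξ a1 a2 a3
  rw [a1, a3, a2, fourier_modulate]

lemma fourierL2_parity (ψ : L2R) : fourierL2 (parity ψ) = parity (fourierL2 ψ) := by
  refine eq_of_eq_on_integrable (Φ := fun ψ => fourierL2 (parity ψ))
    (Ψ := fun ψ => parity (fourierL2 ψ)) (by fun_prop) (by fun_prop) (fun f h1 h2 => ?_) ψ
  have h2' : MemLp (fun x => f (-x)) 2 volume :=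
    h2.comp_measurePreserving (Measure.measurePreserving_neg volume)
  have e : parity h2.toLp = h2'.toLp := by
    refine Lp.ext ?_
    filter_upwards [parity_ae h2.toLp, h2'.coeFn_toLp, ae_comp_neg h2.coeFn_toLp]
      with x a1 a2 a3
    rw [a1, a2, a3]
  rw [e]
  refine Lp.ext ?_
  filter_upwards [fourierL2_toLp_ae h1.comp_neg h2', ae_comp_neg (fourierL2_toLp_ae h1 h2),
    parity_ae (fourierL2 h2.toLp)] with ξ a1 a2 a3
  rw [a1, a3, a2, fourier_comp_neg]

/-! ### Plancherel and strong continuity -/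

/-- The squared norm in `L²` as a Lebesgue integral. -/
lemma lintegral_enorm_sq {α K : Type*} [MeasurableSpace α] {μ : Measure α} [NormedAddCommGroup K]
    (ψ : Lp K 2 μ) : ∫⁻ x, ‖ψ x‖ₑ ^ 2 ∂μ = ENNReal.ofReal (‖ψ‖ ^ 2) := by
  rw [ENNReal.ofReal_pow (norm_nonneg _), ofReal_norm, Lp.enorm_def,
    eLpNorm_eq_lintegral_rpow_enorm_toReal (by norm_num) (by norm_num)]
  rw [← ENNReal.rpow_natCast, ← ENNReal.rpow_mul]
  simp

/-- Plancherel's theorem for functions in `L¹ ∩ L²`. -/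
lemma lintegral_enorm_fourier_sq {f : ℝ → ℂ} (h1 : Integrable f) (h2 : MemLp f 2 volume) :
    ∫⁻ ξ, ‖𝓕 f ξ‖ₑ ^ 2 = ∫⁻ x, ‖f x‖ₑ ^ 2 := by
  have a1 : ∫⁻ ξ, ‖𝓕 f ξ‖ₑ ^ 2 = ∫⁻ ξ, ‖fourierL2 h2.toLp ξ‖ₑ ^ 2 :=
    lintegral_congr_ae ((fourierL2_toLp_ae h1 h2).mono fun x hx => by simp only [hx])
  have a2 : ∫⁻ x, ‖f x‖ₑ ^ 2 = ∫⁻ x, ‖h2.toLp f x‖ₑ ^ 2 :=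
    lintegral_congr_ae (h2.coeFn_toLp.mono fun x hx => by simp only [hx])
  rw [a1, a2, lintegral_enorm_sq, lintegral_enorm_sq, LinearIsometryEquiv.norm_map]

lemma continuous_translation : Continuous fun z : ℝ × L2R => translation z.1 z.2 := by
  let g : ℝ × L2R → C(ℝ, ℝ) := fun z => ⟨fun x => x - z.1, by fun_prop⟩
  have hg : Continuous g := ContinuousMap.continuous_of_continuous_uncurry _ (by
    simp only [g, Function.uncurry_def, ContinuousMap.coe_mk]; fun_prop)
  exact Continuous.compMeasurePreservingLp (continuous_snd (X := ℝ) (Y := L2R)) hg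
    (fun z => measurePreserving_sub_right volume z.1) (by norm_num)

lemma norm_translation (q : ℝ) (ψ : L2R) : ‖translation q ψ‖ = ‖ψ‖ :=
  LinearIsometry.norm_map _ ψ

/-- Fourier conjugation carries isometry and joint continuity over from translations to modulations.
-/
lemma modulation_eq_symm (b : ℝ) (ψ : L2R) :
    modulation b ψ = fourierL2.symm (translation b (fourierL2 ψ)) := by
  rw [← fourierL2_modulation, LinearIsometryEquiv.symm_apply_apply]

lemma norm_modulation (b : ℝ) (ψ : L2R) : ‖modulation b ψ‖ = ‖ψ‖ := by
  rw [modulation_eq_symm, LinearIsometryEquiv.norm_map, norm_translation,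
    LinearIsometryEquiv.norm_map]

lemma continuous_modulation : Continuous fun z : ℝ × L2R => modulation z.1 z.2 := by
  simp only [modulation_eq_symm]
  exact fourierL2.symm.continuous.comp (continuous_translation.comp
    (continuous_fst.prodMk (fourierL2.continuous.comp continuous_snd)))

lemma modulation_translation (a b : ℝ) (ψ : L2R) : modulation b (translation a ψ)
    = (Real.fourierChar (a * b) : ℂ) • translation a (modulation b ψ) := by
  refine Lp.ext ?_
  filter_upwards [modulation_ae b (translation a ψ), translation_ae a ψ,
    Lp.coeFn_smul (Real.fourierChar (a * b) : ℂ) (translation a (modulation b ψ)),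
    translation_ae a (modulation b ψ), ae_comp_sub (modulation_ae b ψ) a] with x h1 h2 h3 h4 h5
  rw [h1, h2, h3, Pi.smul_apply, h4, h5, smul_eq_mul, ← mul_assoc, ← Circle.coe_mul,
    ← AddChar.map_add_eq_mul]
  ring_nf

/-! ### Weyl operators -/

lemma weyl_apply (ħ : ℝ) (z : ℝ × ℝ) (ψ : L2R) :
    weyl ħ z ψ = Complex.exp (Complex.I * (z.1 * z.2 / (2 * ħ) : ℝ)) •
      translation z.1 (modulation (z.2 / (2 * Real.pi * ħ)) ψ) := by
  rw [weyl, boost_eq_modulation]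
  rfl

lemma weyl_ae (ħ : ℝ) (z : ℝ × ℝ) (ψ : L2R) : weyl ħ z ψ =ᵐ[volume] fun x =>
    Complex.exp (Complex.I * (z.2 * x / ħ - z.1 * z.2 / (2 * ħ) : ℝ)) * ψ (x - z.1) := by
  have e : weyl ħ z ψ = Complex.exp (Complex.I * (z.1 * z.2 / (2 * ħ) : ℝ)) •
      translation z.1 (boost ħ z.2 ψ) := rfl
  rw [e]
  filter_upwards [Lp.coeFn_smul (Complex.exp (Complex.I * (z.1 * z.2 / (2 * ħ) : ℝ)))
    (translation z.1 (boost ħ z.2 ψ)), translation_ae z.1 (boost ħ z.2 ψ),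
    ae_comp_sub (boost_ae ħ z.2 ψ) z.1] with x h1 h2 h3
  rw [h1, Pi.smul_apply, h2, h3, smul_eq_mul, ← mul_assoc, ← Complex.exp_add, ← mul_add,
    ← Complex.ofReal_add]
  congr 4
  rcases eq_or_ne ħ 0 with rfl | hħ
  · simp
  · field_simp
    ring

lemma norm_weyl_apply (ħ : ℝ) (z : ℝ × ℝ) (ψ : L2R) : ‖weyl ħ z ψ‖ = ‖ψ‖ := by
  rw [weyl_apply, norm_smul, mul_comm Complex.I, Complex.norm_exp_ofReal_mul_I, one_mul,
    norm_translation, norm_modulation]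

/-- The Weyl relations: phase space translations form a projective representation whose multiplier
comes from the symplectic form. The inverse, and hence the adjoint, of `W(z)` is read off from the
case of opposite arguments. -/
lemma weyl_weyl (ħ : ℝ) (a z : ℝ × ℝ) (ψ : L2R) : weyl ħ a (weyl ħ z ψ)
    = Complex.exp (Complex.I * ((a.2 * z.1 - a.1 * z.2) / (2 * ħ) : ℝ)) • weyl ħ (a + z) ψ := by
  refine Lp.ext ?_
  filter_upwards [weyl_ae ħ a (weyl ħ z ψ), ae_comp_sub (weyl_ae ħ z ψ) a.1,
    Lp.coeFn_smul (Complex.exp (Complex.I * ((a.2 * z.1 - a.1 * z.2) / (2 * ħ) : ℝ)))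
      (weyl ħ (a + z) ψ), weyl_ae ħ (a + z) ψ] with x h1 h2 h3 h4
  rw [h1, h2, h3, Pi.smul_apply, h4, smul_eq_mul, ← mul_assoc, ← mul_assoc, ← Complex.exp_add,
    ← Complex.exp_add, ← mul_add, ← mul_add, ← Complex.ofReal_add, ← Complex.ofReal_add,
    Prod.fst_add, Prod.snd_add, sub_sub]
  congr 4
  rcases eq_or_ne ħ 0 with rfl | hħ
  · simp
  · field_simp
    ring

lemma weyl_zero (ħ : ℝ) (ψ : L2R) : weyl ħ 0 ψ = ψ := by
  refine Lp.ext ?_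
  filter_upwards [weyl_ae ħ 0 ψ] with x h1
  simp [h1]

lemma weyl_weyl_neg (ħ : ℝ) (z : ℝ × ℝ) (ψ : L2R) : weyl ħ z (weyl ħ (-z) ψ) = ψ := by
  rw [weyl_weyl, add_neg_cancel, weyl_zero]
  simp [mul_comm]

lemma inner_weyl_weyl (ħ : ℝ) (z : ℝ × ℝ) (φ ψ : L2R) :
    ⟪weyl ħ z φ, weyl ħ z ψ⟫_ℂ = ⟪φ, ψ⟫_ℂ :=
  (⟨(weyl ħ z).toLinearMap, norm_weyl_apply ħ z⟩ : L2R →ₗᵢ[ℂ] L2R).inner_map_map φ ψ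

lemma adjoint_weyl (ħ : ℝ) (z : ℝ × ℝ) : (weyl ħ z).adjoint = weyl ħ (-z) := by
  refine ContinuousLinearMap.ext fun ψ => ext_inner_left ℂ fun φ => ?_
  rw [ContinuousLinearMap.adjoint_inner_right, ← inner_weyl_weyl ħ z φ, weyl_weyl_neg]

lemma continuous_weyl (ħ : ℝ) (ψ : L2R) : Continuous fun z => weyl ħ z ψ := by
  simp only [weyl_apply]
  have h : Continuous fun z : ℝ × ℝ => Complex.exp (Complex.I * (z.1 * z.2 / (2 * ħ) : ℝ)) := by
    fun_prop
  refine h.smul ?_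
  exact continuous_translation.comp (continuous_fst.prodMk
    (continuous_modulation.comp ((continuous_snd.div_const _).prodMk continuous_const)))

lemma continuous_adjoint_weyl (ħ : ℝ) (ψ : L2R) : Continuous fun z => (weyl ħ z).adjoint ψ := by
  simp only [adjoint_weyl]
  exact (continuous_weyl ħ ψ).comp continuous_neg

/-! ### The ambiguity function -/

/-- The cross-ambiguity function of `f` and `g`. -/
def ambiguity (f g : L2R) (a b : ℝ) : ℂ := ⟪f, modulation b (translation a g)⟫_ℂ

lemma continuous_ambiguity (f g : L2R) : Continuous fun z : ℝ × ℝ => ambiguity f g z.1 z.2 := by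
  have h1 : Continuous fun z : ℝ × ℝ => translation z.1 g :=
    continuous_translation.comp (f := fun z : ℝ × ℝ => (z.1, g)) (by fun_prop)
  have h2 : Continuous fun z : ℝ × ℝ => modulation z.2 (translation z.1 g) :=
    continuous_modulation.comp (f := fun z : ℝ × ℝ => (z.2, translation z.1 g))
      (continuous_snd.prodMk h1)
  exact (innerSL ℂ f).continuous.comp h2

lemma enorm_inner_smul {c : ℂ} (hc : ‖c‖ = 1) (f g : L2R) : ‖⟪f, c • g⟫_ℂ‖ₑ = ‖⟪f, g⟫_ℂ‖ₑ := by
  have h : ‖⟪f, c • g⟫_ℂ‖ = ‖⟪f, g⟫_ℂ‖ := by rw [inner_smul_right, norm_mul, hc, one_mul]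
  rw [← ofReal_norm, ← ofReal_norm, h]

lemma enorm_ambiguity (f g : L2R) (a b : ℝ) :
    ‖ambiguity f g a b‖ₑ = ‖⟪f, translation a (modulation b g)⟫_ℂ‖ₑ := by
  have h := modulation_translation a b g
  have h' := enorm_inner_smul (Circle.norm_coe (Real.fourierChar (a * b))) f
    (translation a (modulation b g))
  rwa [← h] at h'

/-- Phases drop out of absolute values. The rescaling of `p` is the origin of the factor `2πħ` in
all later integrals. -/
lemma enorm_inner_weyl (ħ : ℝ) (f g : L2R) (z : ℝ × ℝ) :
    ‖⟪f, weyl ħ z g⟫_ℂ‖ₑ = ‖ambiguity f g z.1 (z.2 / (2 * Real.pi * ħ))‖ₑ := by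
  rw [weyl_apply, enorm_ambiguity, enorm_inner_smul]
  rw [mul_comm Complex.I, Complex.norm_exp_ofReal_mul_I]

/-- The Fourier transform exchanges translations and modulations, so it acts on phase space as a
quarter turn. -/
lemma enorm_ambiguity_fourierL2 (f g : L2R) (a b : ℝ) :
    ‖ambiguity (fourierL2 f) (fourierL2 g) b (-a)‖ₑ = ‖ambiguity f g a b‖ₑ := by
  rw [enorm_ambiguity f, ambiguity, ← fourierL2_modulation, ← fourierL2_translation,
    LinearIsometryEquiv.inner_map_map]

/-- This form makes Plancherel applicable in the modulation variable. -/
lemma ambiguity_eq_fourier (f g : L2R) (a b : ℝ) :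
    ambiguity f g a b = 𝓕 (fun x => (starRingEnd ℂ) (f x) * g (x - a)) (-b) := by
  rw [ambiguity, L2.inner_def, Real.fourier_real_eq]
  refine integral_congr_ae ?_
  filter_upwards [modulation_ae b (translation a g), translation_ae a g] with x h1 h2
  rw [h1, h2, RCLike.inner_apply, Circle.smul_def, smul_eq_mul]
  rw [show -(x * -b) = b * x by ring]
  ring

lemma measurable_coe (f : L2R) : Measurable (f : ℝ → ℂ) := (Lp.stronglyMeasurable f).measurable

lemma lintegral_lintegral_enorm_mul_sq (f g : L2R) (X : Set ℝ) :
    ∫⁻ a in X, ∫⁻ x, ‖(starRingEnd ℂ) (f x) * g (x - a)‖ₑ ^ 2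
      = ∫⁻ x, ‖f x‖ₑ ^ 2 * ∫⁻ a in X, ‖g (x - a)‖ₑ ^ 2 := by
  have hf := measurable_coe f
  have hg := measurable_coe g
  simp_rw [enorm_mul, mul_pow, RCLike.enorm_conj]
  rw [lintegral_lintegral_swap]
  · refine lintegral_congr fun x => ?_
    rw [lintegral_const_mul _ (by fun_prop)]
  · exact Measurable.aemeasurable (by fun_prop)

lemma lintegral_enorm_comp_sub (g : L2R) (x : ℝ) : ∫⁻ a, ‖g (x - a)‖ₑ ^ 2
    = ENNReal.ofReal (‖g‖ ^ 2) := by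
  rw [lintegral_sub_left_eq_self (fun a => ‖g a‖ₑ ^ 2) x, lintegral_enorm_sq]

/-- The position marginal of the squared ambiguity function. -/
lemma lintegral_ambiguity (f g : L2R) (X : Set ℝ) :
    ∫⁻ a in X, ∫⁻ b, ‖ambiguity f g a b‖ₑ ^ 2
      = ∫⁻ x, ‖f x‖ₑ ^ 2 * ∫⁻ a in X, ‖g (x - a)‖ₑ ^ 2 := by
  rw [← lintegral_lintegral_enorm_mul_sq f g X]
  have hf := measurable_coe f
  have hg := measurable_coe g
  -- The product `conj f · g(· - a)` is integrable for every `a`, but Plancherel also needs it in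
  -- `L²`. Tonelli gives this for almost every `a`, which suffices under the outer integral.
  have hfin : ∀ᵐ a, ∫⁻ x, ‖(starRingEnd ℂ) (f x) * g (x - a)‖ₑ ^ 2 < ∞ := by
    refine ae_lt_top ?_ ?_
    · simp_rw [enorm_mul, mul_pow, RCLike.enorm_conj]
      refine Measurable.lintegral_prod_right'
        (f := fun z : ℝ × ℝ => ‖f z.2‖ₑ ^ 2 * ‖g (z.2 - z.1)‖ₑ ^ 2) ?_
      fun_prop
    · have := lintegral_lintegral_enorm_mul_sq f g univ
      simp only [Measure.restrict_univ] at this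
      rw [this]
      simp_rw [lintegral_enorm_comp_sub]
      rw [lintegral_mul_const _ (by fun_prop), lintegral_enorm_sq]
      exact ENNReal.mul_ne_top ENNReal.ofReal_ne_top ENNReal.ofReal_ne_top
  refine lintegral_congr_ae ((ae_restrict_of_ae hfin).mono fun a ha => ?_)
  have h2 : MemLp (fun x => (starRingEnd ℂ) (f x) * g (x - a)) 2 volume := by
    have hm : AEStronglyMeasurable (fun x => (starRingEnd ℂ) (f x) * g (x - a)) volume :=
      ((continuous_star.measurable.comp hf).mul (hg.comp (measurable_id.sub_const a))).aestronglyMeasurable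
    rw [memLp_two_iff_integrable_sq_norm hm]
    refine ⟨hm.norm.pow 2, ?_⟩
    rw [hasFiniteIntegral_iff_enorm]
    simpa using ha
  have h1 : Integrable (fun x => (starRingEnd ℂ) (f x) * g (x - a)) := by
    refine (L2.integrable_inner (𝕜 := ℂ) f (translation a g)).congr ?_
    filter_upwards [translation_ae a g] with x hx
    rw [hx, RCLike.inner_apply, mul_comm]
  simp only [ambiguity_eq_fourier]
  rw [lintegral_neg_eq_self fun b => ‖𝓕 (fun x => (starRingEnd ℂ) (f x) * g (x - a)) b‖ₑ ^ 2,
    lintegral_enorm_fourier_sq h1 h2]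

/-- The momentum marginal of the squared ambiguity function. -/
lemma lintegral_ambiguity_swap (f g : L2R) (Y : Set ℝ) :
    ∫⁻ b in Y, ∫⁻ a, ‖ambiguity f g a b‖ₑ ^ 2
      = ∫⁻ x, ‖fourierL2 f x‖ₑ ^ 2 * ∫⁻ b in Y, ‖fourierL2 g (x - b)‖ₑ ^ 2 := by
  rw [← lintegral_ambiguity]
  refine lintegral_congr fun b => ?_
  -- Reflecting `a` absorbs the sign produced by the quarter turn.
  rw [← lintegral_neg_eq_self fun a => ‖ambiguity (fourierL2 f) (fourierL2 g) b a‖ₑ ^ 2]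
  simp only [enorm_ambiguity_fourierL2]

/-! ### States as countable mixtures of vectors -/

section States

variable {H : Type*} [NormedAddCommGroup H] [InnerProductSpace ℂ H] [CompleteSpace H]

/-- Distinct basis vectors are at distance `√2`, so the balls of radius `1/2` around them are
disjoint. Countability is what permits exchanging sums over the basis with integrals. -/
lemma countable_basisIndex [TopologicalSpace.SeparableSpace H] : Countable (basisIndex H) := by
  have ho := (basis H).orthonormal
  have hd : (univ : Set (basisIndex H)).PairwiseDisjoint
      fun i => Metric.ball (basis H i) (1 / 2) := by
    intro i _ j _ hij
    refine Metric.ball_disjoint_ball ?_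
    have h : ‖basis H i - basis H j‖ ^ 2 = 2 := by
      rw [@norm_sub_sq ℂ, ho.2 hij, ho.1 i, ho.1 j]
      norm_num
    rw [dist_eq_norm]
    nlinarith [norm_nonneg (basis H i - basis H j)]
  have := hd.countable_of_isOpen (fun i _ => Metric.isOpen_ball)
    (fun i _ => Metric.nonempty_ball.2 (by norm_num))
  exact countable_univ_iff.1 this

lemma tsum_norm_adjoint_sq {R : H →L[ℂ] H}
    (h1 : ∑' i, ENNReal.ofReal (‖R (basis H i)‖ ^ 2) = 1) :
    ∑' i, ENNReal.ofReal (‖R.adjoint (basis H i)‖ ^ 2) = 1 := by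
  rw [← hilbertSchmidt_adjoint (basis H) (basis H) R, h1]

namespace Observable

variable {α : Type*} [MeasurableSpace α]

lemma vectorDistribution_apply (E : Observable α H) (ψ : H) {X : Set α} (hX : MeasurableSet X) :
    E.vectorDistribution ψ X = ENNReal.ofReal (⟪ψ, E X ψ⟫_ℂ).re :=
  Measure.ofMeasurable_apply X hX

lemma distribution_apply (E : Observable α H) (ρ : State H) {X : Set α} (hX : MeasurableSet X) :
    E.distribution ρ X = ENNReal.ofReal (trace (ρ.op ∘L E X)).re :=
  Measure.ofMeasurable_apply X hX

lemma vectorDistribution_univ (E : Observable α H) (ψ : H) :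
    E.vectorDistribution ψ Set.univ = ENNReal.ofReal (‖ψ‖ ^ 2) := by
  rw [vectorDistribution_apply E ψ MeasurableSet.univ, E.univ, one_apply_eq_self,
    inner_self_eq_norm_sq_to_K]
  norm_cast

instance (E : Observable α H) (ψ : H) : IsFiniteMeasure (E.vectorDistribution ψ) :=
  ⟨by rw [vectorDistribution_univ]; exact ENNReal.ofReal_lt_top⟩

instance (E : Observable α H) (ρ : State H) : IsProbabilityMeasure (E.distribution ρ) :=
  ⟨by
    rw [distribution_apply E ρ MeasurableSet.univ, E.univ]
    have : ρ.op ∘L (1 : H →L[ℂ] H) = ρ.op := ContinuousLinearMap.comp_id _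
    rw [this, ρ.trace_eq_one]
    simp⟩

/-- Cyclicity of the trace replaces `tr(R* R E(X))` by `tr(R E(X) R*)`. Claims about states thereby
reduce to claims about the vectors `R* e_j`, whose squared norms add up to one. -/
lemma distribution_eq_sum_of_op_eq (E : Observable α H) (ρ : State H) {R : H →L[ℂ] H}
    (hR : ρ.op = R.adjoint ∘L R) (h1 : ∑' i, ENNReal.ofReal (‖R (basis H i)‖ ^ 2) = 1) :
    E.distribution ρ = Measure.sum fun j => E.vectorDistribution (R.adjoint (basis H j)) := by
  refine Measure.ext fun X hX => ?_
  rw [distribution_apply E ρ hX, Measure.sum_apply _ hX]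
  simp_rw [vectorDistribution_apply E _ hX]
  have h := Complex.hasSum_re (hasSum_trace_comp R (E X) (by rw [h1]; simp) (E.isPositive X))
  rw [hR, ← h.tsum_eq, ENNReal.ofReal_tsum_of_nonneg _ h.summable]
  exact fun n => (E.isPositive X).re_inner_nonneg_right _

lemma distribution_conj_eq_sum (E : Observable α H) (ρ : State H) (U : H ≃ₗᵢ[ℂ] H)
    {R : H →L[ℂ] H} (hR : ρ.op = R.adjoint ∘L R)
    (h1 : ∑' i, ENNReal.ofReal (‖R (basis H i)‖ ^ 2) = 1) :
    E.distribution (ρ.conj U)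
      = Measure.sum fun j => E.vectorDistribution (U (R.adjoint (basis H j))) := by
  have h2 : (R ∘L (U : H →L[ℂ] H).adjoint).adjoint = (U : H →L[ℂ] H) ∘L R.adjoint := by
    rw [ContinuousLinearMap.adjoint_comp, ContinuousLinearMap.adjoint_adjoint]
  rw [distribution_eq_sum_of_op_eq E (ρ.conj U) (R := R ∘L (U : H →L[ℂ] H).adjoint)]
  · rw [h2]
    rfl
  · rw [h2]
    change (U : H →L[ℂ] H) ∘L ρ.op ∘L (U : H →L[ℂ] H).adjoint = _
    rw [hR]
    rfl
  · rw [hilbertSchmidt_adjoint _ (basis H), h2, ← tsum_norm_adjoint_sq h1]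
    simp

/-! ### Smearings -/

lemma measurable_measure_preimage_add (μ : Measure ℝ) [SFinite μ] {X : Set ℝ}
    (hX : MeasurableSet X) : Measurable fun q => μ ((fun x => x + q) ⁻¹' X) :=
  measurable_measure_prodMk_left (s := {z : ℝ × ℝ | z.2 + z.1 ∈ X})
    (hX.preimage (by fun_prop))

variable {E F : Observable ℝ H} {μ : Measure ℝ} [IsProbabilityMeasure μ]

lemma inner_apply_eq_toReal (E : Observable α H) {X : Set α} (hX : MeasurableSet X) (ψ : H) :
    ⟪ψ, E X ψ⟫_ℂ = ((E.vectorDistribution ψ X).toReal : ℂ) := by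
  have h0 : 0 ≤ (⟪ψ, E X ψ⟫_ℂ).re := (E.isPositive X).re_inner_nonneg_right ψ
  rw [vectorDistribution_apply E ψ hX, ENNReal.toReal_ofReal h0]
  have h := (ContinuousLinearMap.isPositive_iff_complex _).1 (E.isPositive X) ψ
  have h' := congrArg (starRingEnd ℂ) h.1
  rw [inner_conj_symm, Complex.conj_ofReal] at h'
  rw [← h']
  simp

/-- All quantities are finite, so the defining identity may be handled with values in `[0, ∞]`,
where Tonelli needs no integrability. -/
lemma isSmearing_iff : F.IsSmearing E μ ↔ ∀ X, MeasurableSet X → ∀ ψ : H,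
    F.vectorDistribution ψ X = ∫⁻ q, μ ((fun x => x + q) ⁻¹' X) ∂(E.vectorDistribution ψ) := by
  refine forall_congr' fun X => forall_congr' fun hX => forall_congr' fun ψ => ?_
  have hfin : ∫⁻ q, μ ((fun x => x + q) ⁻¹' X) ∂(E.vectorDistribution ψ) ≠ ∞ := by
    refine ne_top_of_le_ne_top (measure_ne_top (E.vectorDistribution ψ) Set.univ) ?_
    calc _ ≤ ∫⁻ q, 1 ∂(E.vectorDistribution ψ) := lintegral_mono fun q => prob_le_one
      _ = _ := by simp
  have hint : ∫ q, μ.real ((fun x => x + q) ⁻¹' X) ∂(E.vectorDistribution ψ)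
      = (∫⁻ q, μ ((fun x => x + q) ⁻¹' X) ∂(E.vectorDistribution ψ)).toReal :=
    integral_toReal (measurable_measure_preimage_add μ hX).aemeasurable
      (Filter.Eventually.of_forall fun q => measure_lt_top _ _)
  rw [inner_apply_eq_toReal F hX, hint, Complex.ofReal_inj,
    ENNReal.toReal_eq_toReal_iff' (measure_ne_top _ _) hfin]

lemma IsSmearing.distribution (h : F.IsSmearing E μ) (ρ : State H) {X : Set ℝ}
    (hX : MeasurableSet X) :
    F.distribution ρ X = ∫⁻ q, μ ((fun x => x + q) ⁻¹' X) ∂(E.distribution ρ) := by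
  obtain ⟨R, hR, h1⟩ := ρ.exists_factor
  rw [distribution_eq_sum_of_op_eq F ρ hR h1, distribution_eq_sum_of_op_eq E ρ hR h1,
    Measure.sum_apply _ hX, lintegral_sum_measure]
  exact tsum_congr fun j => isSmearing_iff.1 h X hX _

lemma measurableSet_interval (x w : ℝ) : MeasurableSet (interval x w) := measurableSet_Icc

/-- A smearing is an approximation. -/
lemma IsSmearing.isApproximation (h : F.IsSmearing E μ) : F.IsApproximation E := by
  intro ε hε _
  have hlim : Filter.Tendsto (fun n : ℕ => μ (Icc (-n : ℝ) n)) Filter.atTop (nhds 1) := by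
    have hm : Monotone fun n : ℕ => Icc (-n : ℝ) n := fun m n hmn =>
      Icc_subset_Icc (neg_le_neg (by exact_mod_cast hmn)) (by exact_mod_cast hmn)
    have hu : ⋃ n : ℕ, Icc (-n : ℝ) n = Set.univ := by
      refine eq_univ_of_forall fun x => mem_iUnion.2 ?_
      obtain ⟨n, hn⟩ := exists_nat_ge |x|
      exact ⟨n, abs_le.1 hn⟩
    have := tendsto_measure_iUnion_atTop (μ := μ) hm
    rwa [hu, measure_univ] at this
  have hlt : ENNReal.ofReal (1 - ε) < 1 := by
    rw [ENNReal.ofReal_lt_one]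
    linarith
  obtain ⟨n, hn⟩ := (hlim.eventually (lt_mem_nhds hlt)).exists
  -- Take `δ = 1`: an input `q` lies within `1/2` of `x` and the noise is within `n` with high
  -- probability, so the output is within `n + 1/2` of `x`, whence the width `2n + 1`.
  refine lt_of_le_of_lt (iInf₂_le (1 : ℝ) one_pos) (lt_of_le_of_lt (sInf_le
    ⟨2 * n + 1, by positivity, rfl, fun x ρ hρ => ?_⟩) ENNReal.ofReal_lt_top)
  rw [h.distribution ρ (measurableSet_interval _ _)]
  calc ENNReal.ofReal (1 - ε)
      = ∫⁻ _ in interval x 1, ENNReal.ofReal (1 - ε) ∂(E.distribution ρ) := by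
        rw [setLIntegral_const, hρ, mul_one]
    _ ≤ ∫⁻ q in interval x 1, μ ((fun y => y + q) ⁻¹' interval x (2 * n + 1))
          ∂(E.distribution ρ) := by
        refine setLIntegral_mono' (measurableSet_interval _ _) fun q hq =>
          hn.le.trans (measure_mono fun y hy => ?_)
        simp only [interval, mem_Icc, mem_preimage] at hq hy ⊢
        constructor <;> linarith [hq.1, hq.2, hy.1, hy.2]
    _ ≤ _ := setLIntegral_le_lintegral _ _

/-- If `w` bounds the error bars of a smearing for inputs localized within `δ`, then the noise is
concentrated within `w + δ`. -/
lemma IsSmearing.le_measure_interval (h : F.IsSmearing E μ) {ε δ w : ℝ}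
    (hw : ∀ (x : ℝ) (ρ : State H), E.distribution ρ (interval x δ) = 1 →
      ENNReal.ofReal (1 - ε) ≤ F.distribution ρ (interval x w))
    {t : ℝ} (htδ : t ≤ δ) {ρ : State H} (hρ : E.distribution ρ (interval 0 t) = 1) :
    ENNReal.ofReal (1 - ε) ≤ μ (interval 0 (w + t)) := by
  have hsub : interval 0 t ⊆ interval 0 δ := Icc_subset_Icc (by linarith) (by linarith)
  have hρδ : E.distribution ρ (interval 0 δ) = 1 :=
    le_antisymm prob_le_one (hρ ▸ measure_mono hsub)
  refine (hw 0 ρ hρδ).trans ?_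
  rw [h.distribution ρ (measurableSet_interval _ _)]
  have hae : ∀ᵐ q ∂(E.distribution ρ), q ∈ interval 0 t :=
    (prob_compl_eq_zero_iff (measurableSet_interval _ _)).2 hρ
  calc ∫⁻ q, μ ((fun x => x + q) ⁻¹' interval 0 w) ∂(E.distribution ρ)
      ≤ ∫⁻ _, μ (interval 0 (w + t)) ∂(E.distribution ρ) := by
        refine lintegral_mono_ae (hae.mono fun q hq => measure_mono fun y hy => ?_)
        simp only [interval, mem_Icc, mem_preimage] at hq hy ⊢
        constructor <;> linarith [hq.1, hq.2, hy.1, hy.2]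
    _ = _ := by simp

/-- Uncertainty relations for the noises of smearings imply uncertainty relations for error bar
widths. -/
lemma IsSmearing.le_errorBarWidth_mul {E' F' : Observable ℝ H} {ν : Measure ℝ}
    [IsProbabilityMeasure ν] (h : F.IsSmearing E μ) (h' : F'.IsSmearing E' ν)
    (hE : ∀ t : ℝ, 0 < t → ∃ ρ : State H, E.distribution ρ (interval 0 t) = 1)
    (hE' : ∀ t : ℝ, 0 < t → ∃ ρ : State H, E'.distribution ρ (interval 0 t) = 1)
    {ε ε' c : ℝ} (hε : 0 < ε) (hε1 : ε < 1) (hε' : 0 < ε') (hε1' : ε' < 1)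
    (hc : ∀ w w' : ℝ, 0 < w → 0 < w' → ENNReal.ofReal (1 - ε) ≤ μ (interval 0 w) →
      ENNReal.ofReal (1 - ε') ≤ ν (interval 0 w') → c ≤ w * w') :
    ENNReal.ofReal c ≤ errorBarWidth ε F E * errorBarWidth ε' F' E' := by
  have hfin := (h.isApproximation ε hε hε1).ne
  have hfin' := (h'.isApproximation ε' hε' hε1').ne
  -- Finiteness of both widths excludes the product `0 · ∞`, so the widths can be approximated from
  -- above.
  refine ENNReal.le_mul_of_forall_lt (Or.inr hfin') (Or.inl hfin) fun a ha b hb => ?_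
  simp only [errorBarWidth, error, iInf_lt_iff, sInf_lt_iff, mem_ofPred_eq] at ha hb
  obtain ⟨δ, hδ, _, ⟨w, hw, rfl, hwE⟩, hwa⟩ := ha
  obtain ⟨δ', hδ', _, ⟨w', hw', rfl, hwE'⟩, hwb⟩ := hb
  refine le_trans ?_ (mul_le_mul' hwa.le hwb.le)
  rw [← ENNReal.ofReal_mul hw.le]
  refine ENNReal.ofReal_le_ofReal ?_
  -- Inputs localized within `t` widen the intervals only by `t`, which may be sent to zero once it
  -- is below `δ` and `δ'`.
  have hlim : Filter.Tendsto (fun t : ℝ => (w + t) * (w' + t)) (nhdsWithin 0 (Ioi 0))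
      (nhds (w * w')) := by
    have : Continuous fun t : ℝ => (w + t) * (w' + t) := by fun_prop
    simpa using (this.tendsto 0).mono_left nhdsWithin_le_nhds
  refine ge_of_tendsto hlim ?_
  filter_upwards [Ioc_mem_nhdsGT (lt_min hδ hδ')] with t ht
  obtain ⟨ρ, hρ⟩ := hE t ht.1
  obtain ⟨ρ', hρ'⟩ := hE' t ht.1
  exact hc _ _ (by linarith [ht.1]) (by linarith [ht.1])
    (h.le_measure_interval hwE (ht.2.trans (min_le_left _ _)) hρ)
    (h'.le_measure_interval hwE' (ht.2.trans (min_le_right _ _)) hρ')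

/-! ### Observables from isometries -/

section Isometry

variable {K : Type*} [NormedAddCommGroup K] [InnerProductSpace ℂ K] [CompleteSpace K]
  {μ : Measure α}

/-- Multiplication by an indicator function on `L²(μ; K)`. -/
def indicatorOp (μ : Measure α) (K : Type*) [NormedAddCommGroup K] [InnerProductSpace ℂ K]
    {Z : Set α} (hZ : MeasurableSet Z) : Lp K 2 μ →L[ℂ] Lp K 2 μ :=
  (ContinuousLinearMap.lsmul ℂ ℂ).holderL μ ∞ 2 2
    (((memLp_top_const (1 : ℂ)).indicator hZ : MemLp (Z.indicator fun _ => (1 : ℂ)) ∞ μ).toLp)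

omit [CompleteSpace K] in
lemma inner_indicatorOp {Z : Set α} (hZ : MeasurableSet Z) (f g : Lp K 2 μ) :
    ⟪f, indicatorOp μ K hZ g⟫_ℂ = ∫ z in Z, ⟪f z, g z⟫_ℂ ∂μ := by
  rw [L2.inner_def, ← integral_indicator hZ]
  refine integral_congr_ae ?_
  have hm : MemLp (Z.indicator fun _ => (1 : ℂ)) ∞ μ := (memLp_top_const 1).indicator hZ
  have h := (ContinuousLinearMap.lsmul ℂ ℂ).coeFn_holder (r := 2) hm.toLp g
  filter_upwards [h, hm.coeFn_toLp] with z h1 h2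
  have h3 : indicatorOp μ K hZ g z = Z.indicator (fun _ => (1 : ℂ)) z • g z := by
    rw [← h2]
    exact h1
  rw [h3]
  by_cases hz : z ∈ Z <;> simp [hz]

open Classical in
/-- The observable `Z ↦ V* 1_Z V`, for an isometry `V` into `L²(μ; K)`. -/
def ofIsometry (V : H →ₗᵢ[ℂ] Lp K 2 μ) : Observable α H where
  toFun Z := if hZ : MeasurableSet Z then
    V.toContinuousLinearMap.adjoint ∘L indicatorOp μ K hZ ∘L V.toContinuousLinearMap else 0
  not_measurable Z hZ := dif_neg hZ
  isPositive Z := by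
    split_ifs with hZ
    · refine ContinuousLinearMap.IsPositive.adjoint_conj ?_ V.toContinuousLinearMap
      rw [ContinuousLinearMap.isPositive_iff_complex]
      intro f
      have : ∫ z in Z, ⟪f z, f z⟫_ℂ ∂μ = ((∫ z in Z, ‖f z‖ ^ 2 ∂μ : ℝ) : ℂ) := by
        rw [← integral_complex_ofReal]
        refine integral_congr_ae (Filter.Eventually.of_forall fun z => ?_)
        simp only [inner_self_eq_norm_sq_to_K]
        push_cast; rfl
      rw [← inner_conj_symm, inner_indicatorOp, this, Complex.conj_ofReal]
      refine ⟨by simp, ?_⟩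
      simp only [RCLike.re_eq_complex_re, Complex.ofReal_re]
      exact integral_nonneg fun z => by positivity
    · exact ContinuousLinearMap.isPositive_zero
  univ := by
    rw [dif_pos MeasurableSet.univ]
    refine ContinuousLinearMap.ext fun ψ => ext_inner_left ℂ fun φ => ?_
    simp only [ContinuousLinearMap.comp_apply, ContinuousLinearMap.adjoint_inner_right]
    rw [inner_indicatorOp, setIntegral_univ, ← L2.inner_def, one_apply_eq_self]
    exact V.inner_map_map φ ψ
  hasSum_iUnion X hX hd φ ψ := by
    simp only [hX, MeasurableSet.iUnion hX, dif_pos, ContinuousLinearMap.comp_apply,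
      ContinuousLinearMap.adjoint_inner_right, inner_indicatorOp]
    exact hasSum_integral_iUnion hX hd (L2.integrable_inner (V φ) (V ψ)).integrableOn

lemma inner_ofIsometry (V : H →ₗᵢ[ℂ] Lp K 2 μ) {Z : Set α} (hZ : MeasurableSet Z) (φ ψ : H) :
    ⟪φ, ofIsometry V Z ψ⟫_ℂ = ∫ z in Z, ⟪V φ z, V ψ z⟫_ℂ ∂μ := by
  have : ofIsometry V Z
      = V.toContinuousLinearMap.adjoint ∘L indicatorOp μ K hZ ∘L V.toContinuousLinearMap :=
    dif_pos hZ
  rw [this]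
  simp only [ContinuousLinearMap.comp_apply, ContinuousLinearMap.adjoint_inner_right,
    inner_indicatorOp]
  rfl

end Isometry

end Observable

end States

/-! ### Position and momentum distributions of vectors -/

namespace Observable

variable {H : Type*} [NormedAddCommGroup H] [InnerProductSpace ℂ H] [CompleteSpace H]
variable {α β : Type*} [MeasurableSpace α] [MeasurableSpace β]

lemma map_apply (E : Observable α H) {f : α → β} (hf : Measurable f) {X : Set β}
    (hX : MeasurableSet X) : E.map f hf X = E (f ⁻¹' X) := if_pos hX

lemma vectorDistribution_map (E : Observable α H) {f : α → β} (hf : Measurable f) (ψ : H) :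
    (E.map f hf).vectorDistribution ψ = (E.vectorDistribution ψ).map f := by
  refine Measure.ext fun X hX => ?_
  rw [Measure.map_apply hf hX, vectorDistribution_apply _ _ hX,
    vectorDistribution_apply _ _ (hf hX), map_apply E hf hX]

lemma vectorDistribution_conj (E : Observable α H) (U : H ≃ₗᵢ[ℂ] H) (ψ : H) :
    (E.conj U).vectorDistribution ψ = E.vectorDistribution (U ψ) := by
  refine Measure.ext fun X hX => ?_
  rw [vectorDistribution_apply _ _ hX, vectorDistribution_apply _ _ hX]
  simp only [conj, ContinuousLinearMap.comp_apply, ContinuousLinearMap.adjoint_inner_right]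
  rfl

end Observable

lemma vectorDistribution_position (ψ : L2R) :
    position.vectorDistribution ψ = volume.withDensity fun x => ‖ψ x‖ₑ ^ 2 := by
  refine Measure.ext fun X hX => ?_
  have hp : position X = mulOp _ (memLp_indicator X hX) := dif_pos hX
  have e : ∫ x in X, ⟪ψ x, ψ x⟫_ℂ = ((∫ x in X, ‖ψ x‖ ^ 2 : ℝ) : ℂ) := by
    rw [← integral_complex_ofReal]
    refine integral_congr_ae (Filter.Eventually.of_forall fun x => ?_)
    simp only [inner_self_eq_norm_sq_to_K]
    push_cast; rfl
  have hi : Integrable fun x => ‖ψ x‖ ^ 2 := (Lp.memLp ψ).integrable_norm_pow (by norm_num)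
  rw [Observable.vectorDistribution_apply _ _ hX, withDensity_apply _ hX, hp,
    inner_mulOp_indicator X hX, e, Complex.ofReal_re,
    ofReal_integral_eq_lintegral_ofReal hi.integrableOn
      (Filter.Eventually.of_forall fun x => by positivity)]
  refine lintegral_congr fun x => ?_
  rw [ENNReal.ofReal_pow (norm_nonneg _), ofReal_norm]

lemma vectorDistribution_momentum (ħ : ℝ) (ψ : L2R) : (momentum ħ).vectorDistribution ψ
    = (position.vectorDistribution (fourierL2 ψ)).map fun ξ => 2 * Real.pi * ħ * ξ := by
  rw [momentum, Observable.vectorDistribution_conj, Observable.vectorDistribution_map]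

/-- The position distribution of `Πv`, translated by `x`. -/
lemma vectorDistribution_position_parity_preimage (v : L2R) (x : ℝ) {X : Set ℝ}
    (hX : MeasurableSet X) : position.vectorDistribution (parity v) ((fun y => y + x) ⁻¹' X)
      = ∫⁻ a in X, ‖v (x - a)‖ₑ ^ 2 := by
  have hm : MeasurableSet ((fun y => y + x) ⁻¹' X) := hX.preimage (by fun_prop)
  have hv := measurable_coe v
  rw [vectorDistribution_position, withDensity_apply _ hm,
    ← (measurePreserving_add_right volume x).setLIntegral_comp_preimage hX (by fun_prop)]
  refine lintegral_congr_ae (ae_restrict_of_ae ?_)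
  filter_upwards [parity_ae v] with y hy
  rw [hy, sub_add_cancel_right]

/-! ### Marginals of the matrix coefficients of the Weyl operators -/

lemma setLIntegral_comp_div {c : ℝ} (hc : 0 < c) {Y : Set ℝ} (hY : MeasurableSet Y)
    {f : ℝ → ℝ≥0∞} (hf : Measurable f) :
    ∫⁻ p in Y, f (p / c) = ENNReal.ofReal c * ∫⁻ b in (fun b => c * b) ⁻¹' Y, f b := by
  have hm : Measurable fun b : ℝ => c * b := by fun_prop
  conv_lhs => rw [← Real.smul_map_volume_mul_left hc.ne']
  rw [Measure.restrict_smul, lintegral_smul_measure, Measure.restrict_map hm hY,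
    lintegral_map (by fun_prop) hm, abs_of_pos hc, smul_eq_mul]
  congr 2
  ext b
  rw [mul_div_cancel_left₀ _ hc.ne']

variable {ħ : ℝ}

/-- The `p`-integral is done by Plancherel, and `∫_X |v(x - q)|² dq` is the probability that the
position of `Πv`, shifted by `x`, falls in `X`. -/
lemma lintegral_weyl_fst (hħ : 0 < ħ) (ψ v : L2R) {X : Set ℝ} (hX : MeasurableSet X) :
    ∫⁻ z in Prod.fst ⁻¹' X, ‖⟪ψ, weyl ħ z v⟫_ℂ‖ₑ ^ 2 = ENNReal.ofReal (2 * Real.pi * ħ) *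
      ∫⁻ x, position.vectorDistribution (parity v) ((fun y => y + x) ⁻¹' X)
        ∂(position.vectorDistribution ψ) := by
  have hc : 0 < 2 * Real.pi * ħ := by positivity
  have hA := (continuous_ambiguity ψ v).measurable
  have hψ := measurable_coe ψ
  simp_rw [enorm_inner_weyl, vectorDistribution_position_parity_preimage v _ hX]
  rw [← prod_univ, Measure.volume_eq_prod, ← Measure.prod_restrict, lintegral_prod _
    (by fun_prop), Measure.restrict_univ, vectorDistribution_position,
    lintegral_withDensity_eq_lintegral_mul _ (by fun_prop)]
  · have e : ∀ q, ∫⁻ p, ‖ambiguity ψ v q (p / (2 * Real.pi * ħ))‖ₑ ^ 2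
        = ENNReal.ofReal (2 * Real.pi * ħ) * ∫⁻ b, ‖ambiguity ψ v q b‖ₑ ^ 2 := fun q => by
      have := setLIntegral_comp_div hc MeasurableSet.univ
        (f := fun b => ‖ambiguity ψ v q b‖ₑ ^ 2)
        ((hA.comp (measurable_const.prodMk measurable_id)).enorm.pow_const 2)
      simpa using this
    simp_rw [e]
    rw [lintegral_const_mul, lintegral_ambiguity]
    · rfl
    · exact (hA.enorm.pow_const 2).lintegral_prod_right'
  · have hv := measurable_coe v
    exact Measurable.lintegral_prod_right' (f := fun z : ℝ × ℝ => ‖v (z.1 - z.2)‖ₑ ^ 2)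
      (by fun_prop)

/-- The same argument on the Fourier side; parity commutes with the Fourier transform, and `Y` is
rescaled by `2πħ`. -/
lemma lintegral_weyl_snd (hħ : 0 < ħ) (ψ v : L2R) {Y : Set ℝ} (hY : MeasurableSet Y) :
    ∫⁻ z in Prod.snd ⁻¹' Y, ‖⟪ψ, weyl ħ z v⟫_ℂ‖ₑ ^ 2 = ENNReal.ofReal (2 * Real.pi * ħ) *
      ∫⁻ y, (momentum ħ).vectorDistribution (parity v) ((fun x => x + y) ⁻¹' Y)
        ∂((momentum ħ).vectorDistribution ψ) := by
  have hc : 0 < 2 * Real.pi * ħ := by positivity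
  have hA := (continuous_ambiguity ψ v).measurable
  have hψ := measurable_coe (fourierL2 ψ)
  have hm : Measurable fun ξ => 2 * Real.pi * ħ * ξ := by fun_prop
  have hY' : MeasurableSet ((fun ξ => 2 * Real.pi * ħ * ξ) ⁻¹' Y) := hm hY
  have e : ∀ ξ, (momentum ħ).vectorDistribution (parity v)
      ((fun x => x + 2 * Real.pi * ħ * ξ) ⁻¹' Y)
        = ∫⁻ a in (fun ξ => 2 * Real.pi * ħ * ξ) ⁻¹' Y, ‖fourierL2 v (ξ - a)‖ₑ ^ 2 := fun ξ => by
    rw [vectorDistribution_momentum, Measure.map_apply hm (hY.preimage (by fun_prop)),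
      fourierL2_parity, ← vectorDistribution_position_parity_preimage _ _ hY']
    congr 1
    ext x
    simp [mul_add]
  have hs := Observable.measurable_measure_preimage_add
    ((momentum ħ).vectorDistribution (parity v)) hY
  rw [vectorDistribution_momentum ħ ψ, lintegral_map hs hm]
  simp_rw [enorm_inner_weyl, e]
  rw [← univ_prod, Measure.volume_eq_prod, ← Measure.prod_restrict, lintegral_prod_symm _
    (by fun_prop), Measure.restrict_univ, vectorDistribution_position,
    lintegral_withDensity_eq_lintegral_mul _ (by fun_prop)]
  · have hM : Measurable fun b => ∫⁻ q, ‖ambiguity ψ v q b‖ₑ ^ 2 :=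
      (hA.enorm.pow_const 2).lintegral_prod_left'
    rw [setLIntegral_comp_div hc hY hM, lintegral_ambiguity_swap]
    rfl
  · have hv := measurable_coe (fourierL2 v)
    exact Measurable.lintegral_prod_right' (f := fun z : ℝ × ℝ => ‖fourierL2 v (z.1 - z.2)‖ₑ ^ 2)
      (by fun_prop)

/-! ### The generated observable -/

variable {m : State L2R} {R : L2R →L[ℂ] L2R}

lemma inner_weyl_state (hR : m.op = R.adjoint ∘L R) (φ ψ : L2R) (z : ℝ × ℝ) :
    ⟪φ, weyl ħ z (m.op ((weyl ħ z).adjoint ψ))⟫_ℂ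
      = ⟪R ((weyl ħ z).adjoint φ), R ((weyl ħ z).adjoint ψ)⟫_ℂ := by
  rw [hR, ← ContinuousLinearMap.adjoint_inner_left, ContinuousLinearMap.comp_apply,
    ContinuousLinearMap.adjoint_inner_right]

lemma enorm_factor_weyl_sq (R : L2R →L[ℂ] L2R) (ψ : L2R) (z : ℝ × ℝ) :
    ‖R ((weyl ħ z).adjoint ψ)‖ₑ ^ 2
      = ∑' j, ‖⟪ψ, weyl ħ z (R.adjoint (basis L2R j))⟫_ℂ‖ₑ ^ 2 := by
  have h := parseval (basis L2R) (R ((weyl ħ z).adjoint ψ))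
  rw [ENNReal.ofReal_pow (norm_nonneg _), ofReal_norm] at h
  rw [h]
  refine tsum_congr fun j => ?_
  rw [ENNReal.ofReal_pow (norm_nonneg _), ← ContinuousLinearMap.adjoint_inner_left,
    ContinuousLinearMap.adjoint_inner_right, norm_inner_symm, ofReal_norm]

lemma continuous_factor_weyl (R : L2R →L[ℂ] L2R) (ψ : L2R) :
    Continuous fun z => R ((weyl ħ z).adjoint ψ) :=
  R.continuous.comp (continuous_adjoint_weyl ħ ψ)

instance : Countable (basisIndex L2R) :=
  have : Fact ((2 : ℝ≥0∞) ≠ ∞) := ⟨by norm_num⟩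
  have : SecondCountableTopology L2R := inferInstance
  countable_basisIndex

lemma lintegral_factor_weyl (R : L2R →L[ℂ] L2R) (ψ : L2R) (Z : Set (ℝ × ℝ)) :
    ∫⁻ z in Z, ‖R ((weyl ħ z).adjoint ψ)‖ₑ ^ 2
      = ∑' j, ∫⁻ z in Z, ‖⟪ψ, weyl ħ z (R.adjoint (basis L2R j))⟫_ℂ‖ₑ ^ 2 := by
  simp_rw [enorm_factor_weyl_sq]
  refine lintegral_tsum fun j => Measurable.aemeasurable ?_
  have h : Continuous fun z => ⟪ψ, weyl ħ z (R.adjoint (basis L2R j))⟫_ℂ :=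
    (innerSL ℂ ψ).continuous.comp (continuous_weyl ħ _)
  exact h.measurable.enorm.pow_const 2

lemma lintegral_factor_weyl_fst (hħ : 0 < ħ) (hR : m.op = R.adjoint ∘L R)
    (h1 : ∑' i, ENNReal.ofReal (‖R (basis L2R i)‖ ^ 2) = 1) (ψ : L2R) {X : Set ℝ}
    (hX : MeasurableSet X) :
    ∫⁻ z in Prod.fst ⁻¹' X, ‖R ((weyl ħ z).adjoint ψ)‖ₑ ^ 2
      = ENNReal.ofReal (2 * Real.pi * ħ) *
        ∫⁻ x, positionNoise m ((fun y => y + x) ⁻¹' X) ∂(position.vectorDistribution ψ) := by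
  rw [lintegral_factor_weyl, positionNoise,
    Observable.distribution_conj_eq_sum position m parity hR h1]
  simp_rw [lintegral_weyl_fst hħ ψ _ hX, Measure.sum_apply _ (hX.preimage (measurable_add_const _))]
  rw [lintegral_tsum fun j => (Observable.measurable_measure_preimage_add _ hX).aemeasurable,
    ENNReal.tsum_mul_left]

lemma lintegral_factor_weyl_snd (hħ : 0 < ħ) (hR : m.op = R.adjoint ∘L R)
    (h1 : ∑' i, ENNReal.ofReal (‖R (basis L2R i)‖ ^ 2) = 1) (ψ : L2R) {Y : Set ℝ}
    (hY : MeasurableSet Y) :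
    ∫⁻ z in Prod.snd ⁻¹' Y, ‖R ((weyl ħ z).adjoint ψ)‖ₑ ^ 2
      = ENNReal.ofReal (2 * Real.pi * ħ) *
        ∫⁻ y, momentumNoise ħ m ((fun x => x + y) ⁻¹' Y)
          ∂((momentum ħ).vectorDistribution ψ) := by
  rw [lintegral_factor_weyl, momentumNoise,
    Observable.distribution_conj_eq_sum (momentum ħ) m parity hR h1]
  simp_rw [lintegral_weyl_snd hħ ψ _ hY, Measure.sum_apply _ (hY.preimage (measurable_add_const _))]
  rw [lintegral_tsum fun j => (Observable.measurable_measure_preimage_add _ hY).aemeasurable,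
    ENNReal.tsum_mul_left]

instance (m : State L2R) : IsProbabilityMeasure (positionNoise m) := by
  unfold positionNoise; infer_instance

instance (ħ : ℝ) (m : State L2R) : IsProbabilityMeasure (momentumNoise ħ m) := by
  unfold momentumNoise; infer_instance

/-- Square integrability of the Weyl representation: the noise is a probability measure, so the
marginal formula on the whole line retains only `‖ψ‖²`. -/
lemma lintegral_factor_weyl_univ (hħ : 0 < ħ) (hR : m.op = R.adjoint ∘L R)
    (h1 : ∑' i, ENNReal.ofReal (‖R (basis L2R i)‖ ^ 2) = 1) (ψ : L2R) :
    ∫⁻ z, ‖R ((weyl ħ z).adjoint ψ)‖ₑ ^ 2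
      = ENNReal.ofReal (2 * Real.pi * ħ) * ENNReal.ofReal (‖ψ‖ ^ 2) := by
  have h := lintegral_factor_weyl_fst hħ hR h1 ψ MeasurableSet.univ
  simpa [Observable.vectorDistribution_univ] using h

lemma memLp_factor_weyl (hħ : 0 < ħ) (hR : m.op = R.adjoint ∘L R)
    (h1 : ∑' i, ENNReal.ofReal (‖R (basis L2R i)‖ ^ 2) = 1) (ψ : L2R) :
    MemLp (fun z => R ((weyl ħ z).adjoint ψ)) 2 (volume : Measure (ℝ × ℝ)) := by
  have hm := (continuous_factor_weyl (ħ := ħ) R ψ).aestronglyMeasurable (μ := volume)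
  rw [memLp_two_iff_integrable_sq_norm hm]
  refine ⟨hm.norm.pow 2, ?_⟩
  rw [hasFiniteIntegral_iff_enorm]
  have h := lintegral_factor_weyl_univ hħ hR h1 ψ
  simp only [enorm_pow, enorm_norm, h]
  exact ENNReal.mul_lt_top ENNReal.ofReal_lt_top ENNReal.ofReal_lt_top

/-- The isometry `ψ ↦ (2πħ)^{-1/2} R W(·)* ψ` into `L²(ℝ²; L²(ℝ))`. -/
def weylIsometry (hħ : 0 < ħ) (hR : m.op = R.adjoint ∘L R)
    (h1 : ∑' i, ENNReal.ofReal (‖R (basis L2R i)‖ ^ 2) = 1) :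
    L2R →ₗᵢ[ℂ] Lp L2R 2 (volume : Measure (ℝ × ℝ)) where
  toFun ψ := (((Real.sqrt (2 * Real.pi * ħ))⁻¹ : ℝ) : ℂ) • (memLp_factor_weyl hħ hR h1 ψ).toLp
  map_add' φ ψ := by
    rw [← smul_add, ← MemLp.toLp_add]
    congr 1
    refine MemLp.toLp_congr _ _ (Filter.Eventually.of_forall fun z => ?_)
    simp
  map_smul' c ψ := by
    rw [RingHom.id_apply, smul_comm c, ← MemLp.toLp_const_smul c]
    congr 1
    refine MemLp.toLp_congr _ _ (Filter.Eventually.of_forall fun z => ?_)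
    simp
  norm_map' ψ := by
    have hc : 0 < 2 * Real.pi * ħ := by positivity
    change ‖(((Real.sqrt (2 * Real.pi * ħ))⁻¹ : ℝ) : ℂ) •
      ((memLp_factor_weyl hħ hR h1 ψ).toLp : Lp L2R 2 (volume : Measure (ℝ × ℝ)))‖ = ‖ψ‖
    have h := lintegral_enorm_sq (memLp_factor_weyl hħ hR h1 ψ).toLp
    have e : ∫⁻ z, ‖(memLp_factor_weyl hħ hR h1 ψ).toLp (fun z => R ((weyl ħ z).adjoint ψ)) z‖ₑ ^ 2
        = ∫⁻ z, ‖R ((weyl ħ z).adjoint ψ)‖ₑ ^ 2 :=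
      lintegral_congr_ae ((memLp_factor_weyl hħ hR h1 ψ).coeFn_toLp.mono
        fun z hz => by simp only [hz])
    rw [e, lintegral_factor_weyl_univ hħ hR h1, ← ENNReal.ofReal_mul hc.le,
      ENNReal.ofReal_eq_ofReal_iff (by positivity) (by positivity)] at h
    rw [norm_smul, Complex.norm_real, Real.norm_of_nonneg (by positivity)]
    rw [← sq_eq_sq₀ (by positivity) (by positivity), mul_pow, ← h, inv_pow, Real.sq_sqrt hc.le,
      inv_mul_cancel_left₀ hc.ne']

lemma exists_isGeneratedBy (hħ : 0 < ħ) (m : State L2R) :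
    ∃ G : Observable (ℝ × ℝ) L2R, IsGeneratedBy ħ G m := by
  obtain ⟨R, hR, h1⟩ := m.exists_factor
  have hc : 0 < 2 * Real.pi * ħ := by positivity
  refine ⟨Observable.ofIsometry (weylIsometry hħ hR h1), fun Z hZ φ ψ => ⟨?_, ?_⟩⟩
  · simp_rw [inner_weyl_state hR]
    refine ((L2.integrable_inner (𝕜 := ℂ) (memLp_factor_weyl hħ hR h1 φ).toLp
      (memLp_factor_weyl hħ hR h1 ψ).toLp).congr ?_).integrableOn
    filter_upwards [(memLp_factor_weyl hħ hR h1 φ).coeFn_toLp,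
      (memLp_factor_weyl hħ hR h1 ψ).coeFn_toLp] with z a1 a2
    rw [a1, a2]
  · simp_rw [inner_weyl_state hR]
    rw [Observable.inner_ofIsometry _ hZ, ← integral_const_mul]
    have e : ∀ ψ, weylIsometry hħ hR h1 ψ =ᵐ[volume] fun z =>
        (((Real.sqrt (2 * Real.pi * ħ))⁻¹ : ℝ) : ℂ) • R ((weyl ħ z).adjoint ψ) := fun ψ => by
      filter_upwards [Lp.coeFn_smul (((Real.sqrt (2 * Real.pi * ħ))⁻¹ : ℝ) : ℂ)
        (memLp_factor_weyl hħ hR h1 ψ).toLp, (memLp_factor_weyl hħ hR h1 ψ).coeFn_toLp]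
        with z a1 a2
      rw [← a2]
      exact a1
    refine integral_congr_ae (ae_restrict_of_ae ?_)
    filter_upwards [e φ, e ψ] with z a1 a2
    rw [a1, a2, inner_smul_left, inner_smul_right, Complex.conj_ofReal, ← mul_assoc,
      ← Complex.ofReal_mul, ← mul_inv, Real.mul_self_sqrt hc.le]

variable {G : Observable (ℝ × ℝ) L2R}

lemma IsGeneratedBy.unique {G' : Observable (ℝ × ℝ) L2R} (h : IsGeneratedBy ħ G m)
    (h' : IsGeneratedBy ħ G' m) : G = G' := by
  refine Observable.ext (funext fun Z => ?_)
  by_cases hZ : MeasurableSet Z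
  · refine ContinuousLinearMap.ext fun ψ => ext_inner_left ℂ fun φ => ?_
    rw [(h Z hZ φ ψ).2, (h' Z hZ φ ψ).2]
  · rw [G.not_measurable Z hZ, G'.not_measurable Z hZ]

/-- The multiplier in the Weyl relations occurs once together with its conjugate, and the two
cancel. -/
lemma inner_weyl_state_add (A : L2R →L[ℂ] L2R) (φ ψ : L2R) (a z : ℝ × ℝ) :
    ⟪φ, weyl ħ (a + z) (A ((weyl ħ (a + z)).adjoint ψ))⟫_ℂ
      = ⟪(weyl ħ a).adjoint φ, weyl ħ z (A ((weyl ħ z).adjoint ((weyl ħ a).adjoint ψ)))⟫_ℂ := by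
  set θ := Complex.exp (Complex.I * ((a.2 * z.1 - a.1 * z.2) / (2 * ħ) : ℝ)) with hθ
  have h : weyl ħ a ∘L weyl ħ z = θ • weyl ħ (a + z) :=
    ContinuousLinearMap.ext fun ψ => weyl_weyl ħ a z ψ
  have h' := congrArg ContinuousLinearMap.adjoint h
  rw [ContinuousLinearMap.adjoint_comp, map_smulₛₗ] at h'
  have e1 : ∀ ψ, weyl ħ a (weyl ħ z ψ) = θ • weyl ħ (a + z) ψ := weyl_weyl ħ a z
  have e2 : ∀ ψ, (weyl ħ z).adjoint ((weyl ħ a).adjoint ψ)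
      = (starRingEnd ℂ) θ • (weyl ħ (a + z)).adjoint ψ := fun ψ => DFunLike.congr_fun h' ψ
  have hn : (starRingEnd ℂ) θ * θ = 1 := by
    rw [Complex.conj_mul', hθ, mul_comm Complex.I, Complex.norm_exp_ofReal_mul_I]
    norm_num
  rw [ContinuousLinearMap.adjoint_inner_left, e1, e2, map_smul, map_smul, smul_smul,
    mul_comm, hn, one_smul]

/-- By the cancellation of multipliers, conjugating with `W(a)` shifts the integrand by `a`;
translation invariance of Lebesgue measure moves the shift to `Z`. -/
lemma IsGeneratedBy.isCovariant (h : IsGeneratedBy ħ G m) : IsCovariant ħ G := by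
  intro Z hZ a
  have himg : (fun z => z + a) '' Z = (fun z => z - a) ⁻¹' Z := by
    ext z
    simp [sub_eq_add_neg]
  have hmp := measurePreserving_sub_right (volume : Measure (ℝ × ℝ)) a
  rw [himg]
  refine ContinuousLinearMap.ext fun ψ => ext_inner_left ℂ fun φ => ?_
  rw [(h _ (hZ.preimage (by fun_prop)) φ ψ).2, ContinuousLinearMap.comp_apply,
    ContinuousLinearMap.comp_apply, ← ContinuousLinearMap.adjoint_inner_left, (h Z hZ _ _).2]
  congr 1
  rw [← hmp.setIntegral_preimage_emb (MeasurableEquiv.subRight a).measurableEmbedding]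
  refine integral_congr_ae (Filter.Eventually.of_forall fun z => ?_)
  simp only
  rw [← inner_weyl_state_add, add_sub_cancel]

lemma IsGeneratedBy.vectorDistribution_apply (h : IsGeneratedBy ħ G m) (hħ : 0 < ħ)
    (hR : m.op = R.adjoint ∘L R) (ψ : L2R) {Z : Set (ℝ × ℝ)} (hZ : MeasurableSet Z) :
    ENNReal.ofReal (2 * Real.pi * ħ) * G.vectorDistribution ψ Z
      = ∫⁻ z in Z, ‖R ((weyl ħ z).adjoint ψ)‖ₑ ^ 2 := by
  have hc : 0 < 2 * Real.pi * ħ := by positivity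
  obtain ⟨hi, he⟩ := h Z hZ ψ ψ
  simp_rw [inner_weyl_state hR, inner_self_eq_norm_sq_to_K] at hi he
  have e : ∫ z in Z, ((‖R ((weyl ħ z).adjoint ψ)‖ : ℂ)) ^ 2
      = ((∫ z in Z, ‖R ((weyl ħ z).adjoint ψ)‖ ^ 2 : ℝ) : ℂ) := by
    rw [← integral_complex_ofReal]
    push_cast; rfl
  have hi' : IntegrableOn (fun z => ‖R ((weyl ħ z).adjoint ψ)‖ ^ 2) Z := by
    refine hi.re.congr (Filter.Eventually.of_forall fun z => ?_)
    simp only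
    norm_cast
  rw [Observable.vectorDistribution_apply _ _ hZ, he]
  erw [e]
  rw [← Complex.ofReal_mul, Complex.ofReal_re, ← ENNReal.ofReal_mul hc.le,
    mul_inv_cancel_left₀ hc.ne', ofReal_integral_eq_lintegral_ofReal hi'
      (Filter.Eventually.of_forall fun x => by positivity)]
  refine lintegral_congr fun x => ?_
  rw [ENNReal.ofReal_pow (norm_nonneg _), ofReal_norm]

lemma IsGeneratedBy.isSmearing_fst (h : IsGeneratedBy ħ G m) (hħ : 0 < ħ) :
    G.fst.IsSmearing position (positionNoise m) := by
  obtain ⟨R, hR, h1⟩ := m.exists_factor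
  have hc : 0 < 2 * Real.pi * ħ := by positivity
  refine Observable.isSmearing_iff.2 fun X hX ψ => ?_
  have := h.vectorDistribution_apply hħ hR ψ (measurable_fst hX)
  rw [lintegral_factor_weyl_fst hħ hR h1 ψ hX] at this
  rw [Observable.fst, Observable.vectorDistribution_map, Measure.map_apply measurable_fst hX]
  exact (ENNReal.mul_right_inj (by simpa using hc) ENNReal.ofReal_ne_top).1 this

lemma IsGeneratedBy.isSmearing_snd (h : IsGeneratedBy ħ G m) (hħ : 0 < ħ) :
    G.snd.IsSmearing (momentum ħ) (momentumNoise ħ m) := by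
  obtain ⟨R, hR, h1⟩ := m.exists_factor
  have hc : 0 < 2 * Real.pi * ħ := by positivity
  refine Observable.isSmearing_iff.2 fun Y hY ψ => ?_
  have := h.vectorDistribution_apply hħ hR ψ (measurable_snd hY)
  rw [lintegral_factor_weyl_snd hħ hR h1 ψ hY] at this
  rw [Observable.snd, Observable.vectorDistribution_map, Measure.map_apply measurable_snd hY]
  exact (ENNReal.mul_right_inj (by simpa using hc) ENNReal.ofReal_ne_top).1 this

/-! ### Vector states and pairs of projections -/

section Pure

variable {H : Type*} [NormedAddCommGroup H] [InnerProductSpace ℂ H] [CompleteSpace H]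

/-- Vector states. -/
lemma exists_state_distribution_eq {v : H} (hv : ‖v‖ = 1) : ∃ ρ : State H,
    ∀ {α : Type} [MeasurableSpace α] (E : Observable α H),
      E.distribution ρ = E.vectorDistribution v := by
  -- The rank-one projection onto `v` serves as its own factor: each `A* e_j` is a multiple of `v`,
  -- and the squared coefficients sum to `‖v‖² = 1`.
  let A : H →L[ℂ] H := (innerSL ℂ v).smulRight v
  have hA : ∀ x, A x = ⟪v, x⟫_ℂ • v := fun x => rfl
  have hadj : A.adjoint = A := by
    refine ContinuousLinearMap.ext fun x => ext_inner_left ℂ fun y => ?_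
    rw [ContinuousLinearMap.adjoint_inner_right, hA, hA, inner_smul_left, inner_smul_right,
      inner_conj_symm, mul_comm]
  have h1 : ∑' i, ENNReal.ofReal (‖A (basis H i)‖ ^ 2) = 1 := by
    have := parseval (basis H) v
    rw [hv, one_pow, ENNReal.ofReal_one] at this
    rw [this]
    refine tsum_congr fun i => ?_
    rw [hA, norm_smul, hv, mul_one, norm_inner_symm]
  let ρ : State H := ⟨A.adjoint ∘L A, ContinuousLinearMap.isPositive_adjoint_comp_self A,
    trace_adjoint_comp_self A h1⟩
  refine ⟨ρ, fun E => Measure.ext fun X hX => ?_⟩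
  rw [E.distribution_eq_sum_of_op_eq ρ rfl h1, Measure.sum_apply _ hX]
  have e : ∀ i, E.vectorDistribution (A.adjoint (basis H i)) X
      = ENNReal.ofReal (‖A (basis H i)‖ ^ 2) * E.vectorDistribution v X := fun i => by
    have e1 : ⟪A (basis H i), E X (A (basis H i))⟫_ℂ
        = ((‖A (basis H i)‖ ^ 2 : ℝ) : ℂ) * ⟪v, E X v⟫_ℂ := by
      rw [hA, map_smul, inner_smul_left, inner_smul_right, ← mul_assoc, Complex.conj_mul',
        norm_smul, hv, mul_one]
      push_cast; rfl
    rw [hadj, E.vectorDistribution_apply _ hX, E.vectorDistribution_apply _ hX, e1,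
      Complex.re_ofReal_mul, ENNReal.ofReal_mul (by positivity)]
  simp_rw [e]
  rw [ENNReal.tsum_mul_right, h1, one_mul]

omit [CompleteSpace H] in
/-- The uncertainty relation for two projections. -/
lemma re_inner_add_re_inner_le {P Q : H →L[ℂ] H} (hP : P.IsPositive) (hQ : Q.IsPositive)
    (hP2 : ∀ ψ, P (P ψ) = P ψ) (hQ2 : ∀ ψ, Q (Q ψ) = Q ψ) {c : ℝ} (hc : 0 ≤ c)
    (hPQ : ∀ ψ, ‖P (Q ψ)‖ ≤ c * ‖Q ψ‖) (ψ : H) :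
    (⟪ψ, Q ψ⟫_ℂ).re + (⟪ψ, P ψ⟫_ℂ).re ≤ (1 + c) * ‖ψ‖ ^ 2 := by
  have hs : ∀ {T : H →L[ℂ] H}, T.IsPositive → (∀ ψ, T (T ψ) = T ψ) →
      (⟪ψ, T ψ⟫_ℂ).re = ‖T ψ‖ ^ 2 := fun {T} hT hT2 => by
    rw [← hT2 ψ, ← hT.inner_left_eq_inner_right, hT2, inner_self_eq_norm_sq_to_K]
    norm_cast
  -- Since `P` is a projection, `⟨Qψ, Pψ⟩ = ⟨PQψ, Pψ⟩`, and the bound on `PQ` applies.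
  have hcross : (⟪Q ψ, P ψ⟫_ℂ).re ≤ c * ‖Q ψ‖ * ‖P ψ‖ := by
    rw [← hP2 ψ, ← hP.inner_left_eq_inner_right, hP2]
    exact (Complex.re_le_norm _).trans ((norm_inner_le_norm _ _).trans
      (mul_le_mul_of_nonneg_right (hPQ ψ) (norm_nonneg _)))
  have hsum : ‖Q ψ + P ψ‖ ^ 2 = ‖Q ψ‖ ^ 2 + 2 * (⟪Q ψ, P ψ⟫_ℂ).re + ‖P ψ‖ ^ 2 :=
    norm_add_sq (𝕜 := ℂ) _ _
  have hle : (⟪ψ, Q ψ⟫_ℂ).re + (⟪ψ, P ψ⟫_ℂ).re ≤ ‖ψ‖ * ‖Q ψ + P ψ‖ := by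
    rw [← Complex.add_re, ← inner_add_right]
    exact (Complex.re_le_norm _).trans (norm_inner_le_norm _ _)
  rw [hs hQ hQ2, hs hP hP2] at *
  set s := ‖Q ψ‖ ^ 2 + ‖P ψ‖ ^ 2 with hsdef
  have hs0 : 0 ≤ s := by positivity
  have h1 : ‖Q ψ + P ψ‖ ^ 2 ≤ (1 + c) * s := by
    have := mul_nonneg hc (sq_nonneg (‖Q ψ‖ - ‖P ψ‖))
    nlinarith
  -- Here `s = ⟨ψ, (Q + P)ψ⟩`. Cauchy-Schwarz bounds `s²` by a multiple of `s` itself, so dividing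
  -- by `s` (when nonzero) gives the claim.
  have h2 : s ^ 2 ≤ ‖ψ‖ ^ 2 * ((1 + c) * s) := by
    calc s ^ 2 ≤ (‖ψ‖ * ‖Q ψ + P ψ‖) ^ 2 := by gcongr
      _ = ‖ψ‖ ^ 2 * ‖Q ψ + P ψ‖ ^ 2 := by ring
      _ ≤ _ := by gcongr
  rcases hs0.eq_or_lt with h0 | h0
  · rw [← h0]; positivity
  · nlinarith

end Pure

/-! ### Concentration in position and momentum -/

lemma position_apply_ae {X : Set ℝ} (hX : MeasurableSet X) (ψ : L2R) :
    position X ψ =ᵐ[volume] X.indicator ψ := by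
  have hp : position X = mulOp _ (memLp_indicator X hX) := dif_pos hX
  rw [hp]
  filter_upwards [mulOp_ae _ (memLp_indicator X hX) ψ] with x hx
  rw [hx]
  by_cases h : x ∈ X <;> simp [h]

lemma position_position {X : Set ℝ} (hX : MeasurableSet X) (ψ : L2R) :
    position X (position X ψ) = position X ψ := by
  refine Lp.ext ?_
  filter_upwards [position_apply_ae hX (position X ψ), position_apply_ae hX ψ] with x h1 h2
  rw [h1]
  by_cases h : x ∈ X
  · rw [indicator_of_mem h]
  · rw [h2, indicator_of_notMem h, indicator_of_notMem h]

lemma momentum_apply (ħ : ℝ) {Y : Set ℝ} (hY : MeasurableSet Y) (ψ : L2R) : momentum ħ Y ψ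
    = fourierL2.symm (position ((fun ξ => 2 * Real.pi * ħ * ξ) ⁻¹' Y) (fourierL2 ψ)) := by
  refine ext_inner_left ℂ fun φ => ?_
  rw [← fourierL2.inner_map_map φ (fourierL2.symm _), LinearIsometryEquiv.apply_symm_apply]
  simp only [momentum, Observable.conj, ContinuousLinearMap.comp_apply,
    ContinuousLinearMap.adjoint_inner_right, Observable.map_apply _ _ hY]
  rfl

lemma momentum_momentum (ħ : ℝ) {Y : Set ℝ} (hY : MeasurableSet Y) (ψ : L2R) :
    momentum ħ Y (momentum ħ Y ψ) = momentum ħ Y ψ := by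
  rw [momentum_apply ħ hY, momentum_apply ħ hY, LinearIsometryEquiv.apply_symm_apply,
    position_position (hY.preimage (by fun_prop))]

lemma ofReal_norm_position_sq {X : Set ℝ} (hX : MeasurableSet X) (ψ : L2R) :
    ENNReal.ofReal (‖position X ψ‖ ^ 2) = ∫⁻ x in X, ‖ψ x‖ₑ ^ 2 := by
  rw [← lintegral_enorm_sq, ← lintegral_indicator hX]
  refine lintegral_congr_ae ?_
  filter_upwards [position_apply_ae hX ψ] with x hx
  rw [hx]
  by_cases h : x ∈ X <;> simp [h]

lemma enorm_fourier_le (f : ℝ → ℂ) (ξ : ℝ) : ‖𝓕 f ξ‖ₑ ≤ ∫⁻ x, ‖f x‖ₑ := by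
  rw [Real.fourier_real_eq]
  refine (enorm_integral_le_lintegral_enorm _).trans (le_of_eq (lintegral_congr fun x => ?_))
  rw [← ofReal_norm, Circle.norm_smul, ofReal_norm]

/-- Concentration of a function and of its Fourier transform. -/
lemma norm_position_fourierL2_position_sq_le {X Y : Set ℝ} (hX : MeasurableSet X)
    (hY : MeasurableSet Y) (hXf : volume X ≠ ∞) (ψ : L2R) :
    ENNReal.ofReal (‖position Y (fourierL2 (position X ψ))‖ ^ 2)
      ≤ volume X * volume Y * ENNReal.ofReal (‖position X ψ‖ ^ 2) := by
  set u := position X ψ with hu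
  have hfin : IsFiniteMeasure (volume.restrict X) := ⟨by simpa using hXf.lt_top⟩
  have huX : (u : ℝ → ℂ) =ᵐ[volume] X.indicator u := by
    have := position_apply_ae hX u
    rwa [hu, position_position hX, ← hu] at this
  have h2X : MemLp u 2 (volume.restrict X) := (Lp.memLp u).restrict X
  -- On a set of finite measure `L²` embeds in `L¹`, so the transform of `u` is an honest integral,
  -- bounded pointwise by `‖u‖₁ ≤ |X|^{1/2} ‖u‖₂`. Integrating the square over `Y` gives the factor
  -- `|X| |Y|`.
  have h1X : IntegrableOn u X := h2X.integrable (by norm_num)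
  have h1 : Integrable u := (h1X.integrable_indicator hX).congr huX.symm
  have hF : fourierL2 u =ᵐ[volume] 𝓕 (u : ℝ → ℂ) := by
    have := fourierL2_toLp_ae h1 (Lp.memLp u)
    rwa [Lp.toLp_coeFn] at this
  have hL1 : ∫⁻ x, ‖u x‖ₑ = eLpNorm u 1 (volume.restrict X) := by
    rw [eLpNorm_one_eq_lintegral_enorm, ← lintegral_indicator hX]
    refine lintegral_congr_ae (huX.mono fun x hx => ?_)
    simp only
    rw [hx]
    by_cases h : x ∈ X <;> simp [h]
  have hCS : (∫⁻ x, ‖u x‖ₑ) ^ 2 ≤ ENNReal.ofReal (‖u‖ ^ 2) * volume X := by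
    have h := eLpNorm_le_eLpNorm_mul_rpow_measure_univ (p := 1) (q := 2) one_le_two h2X.1
    rw [hL1]
    calc _ ≤ (eLpNorm u 2 (volume.restrict X) * (volume.restrict X) univ ^
          (1 / (1 : ℝ≥0∞).toReal - 1 / (2 : ℝ≥0∞).toReal)) ^ 2 := by gcongr
      _ ≤ (eLpNorm u 2 volume * volume X ^ (1 / 2 : ℝ)) ^ 2 := by
        gcongr
        · exact Measure.restrict_le_self
        · refine le_of_eq ?_
          rw [Measure.restrict_apply_univ]
          norm_num
      _ = _ := by
        rw [mul_pow, ENNReal.ofReal_pow (norm_nonneg _), ofReal_norm, Lp.enorm_def,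
          ← ENNReal.rpow_natCast (volume X ^ _), ← ENNReal.rpow_mul]
        norm_num
  rw [ofReal_norm_position_sq hY]
  calc ∫⁻ ξ in Y, ‖fourierL2 u ξ‖ₑ ^ 2 = ∫⁻ ξ in Y, ‖𝓕 (u : ℝ → ℂ) ξ‖ₑ ^ 2 :=
        lintegral_congr_ae (ae_restrict_of_ae (hF.mono fun x hx => by simp only [hx]))
    _ ≤ ∫⁻ _ in Y, ENNReal.ofReal (‖u‖ ^ 2) * volume X := by
        refine lintegral_mono fun ξ => le_trans ?_ hCS
        gcongr
        exact enorm_fourier_le _ _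
    _ = _ := by
        rw [setLIntegral_const]
        ring

/-- The joint concentration bound for the position and momentum distributions of a state. -/
lemma mul_sq_le_of_concentrated {ħ : ℝ} (hħ : 0 < ħ) (ρ : State L2R) {ε ε' w w' : ℝ}
    (hε : ε + ε' < 1) (hw : 0 < w) (hw' : 0 < w')
    (h : ENNReal.ofReal (1 - ε) ≤ position.distribution ρ (Observable.interval 0 w))
    (h' : ENNReal.ofReal (1 - ε') ≤ (momentum ħ).distribution ρ (Observable.interval 0 w')) :
    2 * Real.pi * ħ * (1 - ε - ε') ^ 2 ≤ w * w' := by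
  obtain ⟨R, hR, h1⟩ := ρ.exists_factor
  have hc0 : 0 < 2 * Real.pi * ħ := by positivity
  have hX := Observable.measurableSet_interval 0 w
  have hY := Observable.measurableSet_interval 0 w'
  have hY' : MeasurableSet ((fun ξ => 2 * Real.pi * ħ * ξ) ⁻¹' Observable.interval 0 w') :=
    hY.preimage (by fun_prop)
  have hv : ∀ r, volume (Observable.interval 0 r) = ENNReal.ofReal r := fun r => by
    rw [Observable.interval, Real.volume_Icc]
    congr 1
    ring
  -- `c²` is the length of the position interval times the length of the frequency interval, which
  -- is `w'/2πħ`.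
  set c := Real.sqrt (w * w' / (2 * Real.pi * ħ)) with hc
  have hPQ : ∀ ψ, ‖momentum ħ (Observable.interval 0 w') (position (Observable.interval 0 w) ψ)‖
      ≤ c * ‖position (Observable.interval 0 w) ψ‖ := fun ψ => by
    have := norm_position_fourierL2_position_sq_le hX hY' (by simp [hv]) ψ
    rw [Real.volume_preimage_mul_left hc0.ne', hv, hv, abs_of_pos (inv_pos.2 hc0),
      ← ENNReal.ofReal_mul (by positivity), ← ENNReal.ofReal_mul (by positivity),
      ← ENNReal.ofReal_mul (by positivity), ENNReal.ofReal_le_ofReal_iff (by positivity)] at this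
    rw [momentum_apply ħ hY, LinearIsometryEquiv.norm_map]
    refine (abs_le_of_sq_le_sq' ?_ (by positivity)).2
    rw [mul_pow, hc, Real.sq_sqrt (by positivity)]
    refine this.trans (le_of_eq ?_)
    field_simp
  have hj : ∀ v, position.vectorDistribution v (Observable.interval 0 w)
      + (momentum ħ).vectorDistribution v (Observable.interval 0 w')
        ≤ ENNReal.ofReal (1 + c) * ENNReal.ofReal (‖v‖ ^ 2) := fun v => by
    have a1 : 0 ≤ (⟪v, position (Observable.interval 0 w) v⟫_ℂ).re :=
      (position.isPositive _).re_inner_nonneg_right v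
    have a2 : 0 ≤ (⟪v, momentum ħ (Observable.interval 0 w') v⟫_ℂ).re :=
      ((momentum ħ).isPositive _).re_inner_nonneg_right v
    rw [Observable.vectorDistribution_apply _ _ hX, Observable.vectorDistribution_apply _ _ hY,
      ← ENNReal.ofReal_add a1 a2,
      ← ENNReal.ofReal_mul (by positivity)]
    exact ENNReal.ofReal_le_ofReal (re_inner_add_re_inner_le ((momentum ħ).isPositive _)
      (position.isPositive _) (momentum_momentum ħ hY) (position_position hX)
      (Real.sqrt_nonneg _) hPQ v)
  have hsum : ENNReal.ofReal (1 - ε) + ENNReal.ofReal (1 - ε') ≤ ENNReal.ofReal (1 + c) := by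
    refine (add_le_add h h').trans ?_
    rw [Observable.distribution_eq_sum_of_op_eq _ ρ hR h1,
      Observable.distribution_eq_sum_of_op_eq _ ρ hR h1, Measure.sum_apply _ hX,
      Measure.sum_apply _ hY, ← ENNReal.tsum_add]
    refine (ENNReal.tsum_le_tsum fun j => hj _).trans ?_
    rw [ENNReal.tsum_mul_left, tsum_norm_adjoint_sq h1, mul_one]
  have hle : 1 - ε - ε' ≤ c := by
    have := ENNReal.ofReal_add_le.trans hsum
    rw [ENNReal.ofReal_le_ofReal_iff (by positivity)] at this
    linarith
  have hsq : (1 - ε - ε') ^ 2 ≤ w * w' / (2 * Real.pi * ħ) := by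
    rw [← Real.sq_sqrt (show 0 ≤ w * w' / (2 * Real.pi * ħ) by positivity), ← hc]
    gcongr
    linarith
  rw [le_div_iff₀ hc0] at hsq
  linarith

/-! ### Localized states -/

/-- The normalized indicator function of `X` does it. -/
lemma exists_norm_one_position_localized {X : Set ℝ} (hX : MeasurableSet X) (h0 : volume X ≠ 0)
    (hfin : volume X ≠ ∞) : ∃ v : L2R, ‖v‖ = 1 ∧ position.vectorDistribution v X = 1 := by
  set f : L2R := indicatorConstLp 2 hX hfin (1 : ℂ) with hf
  have hfX : position X f = f := by
    refine Lp.ext ?_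
    filter_upwards [position_apply_ae hX f, indicatorConstLp_coeFn (p := 2) (hs := hX)
      (hμs := hfin) (c := (1 : ℂ))] with x h1 h2
    rw [h1]
    by_cases h : x ∈ X
    · rw [indicator_of_mem h]
    · rw [indicator_of_notMem h, h2, indicator_of_notMem h]
  have hn : ‖f‖ ≠ 0 := by
    rw [hf, norm_indicatorConstLp (by norm_num) (by norm_num), norm_one, one_mul]
    exact (Real.rpow_pos_of_pos (ENNReal.toReal_pos h0 hfin) _).ne'
  have hv : ‖((‖f‖⁻¹ : ℝ) : ℂ) • f‖ = 1 := by
    rw [norm_smul, Complex.norm_real, norm_inv, norm_norm, inv_mul_cancel₀ hn]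
  refine ⟨((‖f‖⁻¹ : ℝ) : ℂ) • f, hv, ?_⟩
  rw [Observable.vectorDistribution_apply _ _ hX, map_smul, hfX, inner_self_eq_norm_sq_to_K, hv]
  norm_num

lemma exists_state_position_localized {t : ℝ} (ht : 0 < t) :
    ∃ ρ : State L2R, position.distribution ρ (Observable.interval 0 t) = 1 := by
  obtain ⟨v, hv, h⟩ := exists_norm_one_position_localized
    (Observable.measurableSet_interval 0 t)
    (by simp [Observable.interval, ht]) (by simp [Observable.interval])
  obtain ⟨ρ, hρ⟩ := exists_state_distribution_eq hv
  exact ⟨ρ, by rw [hρ, h]⟩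

lemma exists_state_momentum_localized {ħ : ℝ} (hħ : 0 < ħ) {t : ℝ} (ht : 0 < t) :
    ∃ ρ : State L2R, (momentum ħ).distribution ρ (Observable.interval 0 t) = 1 := by
  have hc0 : 0 < 2 * Real.pi * ħ := by positivity
  have hm : Measurable fun ξ => 2 * Real.pi * ħ * ξ := by fun_prop
  have hY := Observable.measurableSet_interval 0 t
  have hvol : volume ((fun ξ => 2 * Real.pi * ħ * ξ) ⁻¹' Observable.interval 0 t)
      = ENNReal.ofReal ((2 * Real.pi * ħ)⁻¹ * t) := by
    rw [Real.volume_preimage_mul_left hc0.ne', Observable.interval, Real.volume_Icc,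
      abs_of_pos (inv_pos.2 hc0), ← ENNReal.ofReal_mul (by positivity)]
    congr 1
    ring
  obtain ⟨v, hv, h⟩ := exists_norm_one_position_localized (hm hY)
    (by rw [hvol, ENNReal.ofReal_ne_zero_iff]; positivity) (by rw [hvol]; exact ENNReal.ofReal_ne_top)
  obtain ⟨ρ, hρ⟩ := exists_state_distribution_eq
    ((fourierL2.symm.norm_map v).trans hv)
  refine ⟨ρ, ?_⟩
  rw [hρ, vectorDistribution_momentum, Measure.map_apply hm hY,
    LinearIsometryEquiv.apply_symm_apply, h]

end PhaseSpace

end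

open PhaseSpace
theorem proposition4 (ħ : ℝ) (hħ : 0 < ħ) (m : State L2R) :
    (∃! G : Observable (ℝ × ℝ) L2R, IsGeneratedBy ħ G m) ∧
    ∀ G : Observable (ℝ × ℝ) L2R, IsGeneratedBy ħ G m →
      IsCovariant ħ G ∧
      G.fst.IsSmearing position (positionNoise m) ∧
      G.snd.IsSmearing (momentum ħ) (momentumNoise ħ m) ∧
      G.IsApproximateJoint position (momentum ħ) ∧
      ∀ ε₁ ε₂ : ℝ, 0 < ε₁ → 0 < ε₂ → ε₁ + ε₂ < 1 →
        ENNReal.ofReal (2 * Real.pi * ħ * (1 - ε₁ - ε₂) ^ 2) ≤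
          Observable.errorBarWidth ε₁ G.fst position *
            Observable.errorBarWidth ε₂ G.snd (momentum ħ) := by
  refine ⟨?_, fun G hG => ?_⟩
  · obtain ⟨G, hG⟩ := exists_isGeneratedBy hħ m
    exact ⟨G, hG, fun G' hG' => hG'.unique hG⟩
  · have h1 := hG.isSmearing_fst hħ
    have h2 := hG.isSmearing_snd hħ
    refine ⟨hG.isCovariant, h1, h2, ⟨h1.isApproximation, h2.isApproximation⟩, ?_⟩
    intro ε₁ ε₂ hε₁ hε₂ hε
    -- Both noises are by definition distributions of the one state `ΠmΠ*`, so the concentration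
    -- bound relates them.
    exact h1.le_errorBarWidth_mul h2 (fun t ht => exists_state_position_localized ht)
      (fun t ht => exists_state_momentum_localized hħ ht) hε₁ (by linarith) hε₂ (by linarith)
      fun w w' hw hw' a1 a2 => mul_sq_le_of_concentrated hħ (m.conj parity) hε hw hw' a1 a2
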